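/- **Model.** Let $m\ge 1$ pages and a bandwidth $R>0$ be given. Page $i$ changes at the event times of a Poisson process of rate $\xi_i$ and is requested at the event times of a Poisson process of rate $\zeta_i>0$. The $\zeta_i$ are known; the $\xi_i$ are unknown, but satisfy $0<\xi_{\min}\le\xi_i\le\xi_{\max}$ with known bounds. The crawler may draw refresh times from Poisson processes. All these processes are mutually independent. The cache is empty before the first refresh. Page $i$ is *fresh* at time $t$ if it was refreshed before $t$ and its last refresh before $t$ is later than its last change before $t$, if any. The utility $U([t_1,t_2],\pi)$ of a policy $\pi$ is $\frac1m$ times the number of requests in $[t_1,t_2]$ that find a fresh page. Let $\Delta_R=\{\rho\in[0,\infty)^m:\sum_i\rho_i=R\}$; the policy $\rho\in\Delta_R$ refreshes page $i$ at the events of a Poisson process of rate $\rho_i$. Put $F(\rho;\xi)=\sum_{i=1}^m\frac{\rho_i\zeta_i}{\rho_i+\xi_i}$. **Explore-and-commit.** Let $\tau=N\frac mR$ with an integer $N\ge1$, and let $T\ge\tau$. The policy $\pi^{\mathrm{ec}}$ refreshes every page at the times $n\frac mR$, $n=0,1,\dots,N$. At each $n\ge1$ it observes only whether the page has changed since the previous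 refresh. Let $\hat p_i$ be the fraction of the $N$ windows of page $i$ without a change, let $\tilde\xi_i\in[0,\infty]$ be the solution of $\hat p_i=\frac1N\sum_{n=1}^N e^{-\tilde\xi_i m/R}$, and let $\hat\xi_i=\max\{\xi_{\min},\min\{\xi_{\max},\tilde\xi_i\}\}$. From time $\tau$ to time $T$ it follows the Poisson policy with rates $\hat\rho=\operatorname{argmax}_{\rho\in\Delta_R}F(\rho;\hat\xi)$. **Regret.** Let $$\mathcal R(T)=\sup_{\rho\in\Delta_R}\mathbf E\,U([0,T],\rho)-\mathbf E\bigl[U([0,T],\pi^{\mathrm{ec}})\mid\text{observations of the exploration phase}\bigr],$$ and let its stationary approximation be $$\mathcal R^{\mathrm{st}}(T)=\tfrac Tm\sup_{\rho\in\Delta_R}F(\rho;\xi)-\mathbf E\,U([0,\tau],\pi^{\mathrm{ec}})-\tfrac{T-\tau}mF(\hat\rho;\xi).$$ Both are random variables that depend on the exploration phase. **Theorem.** Let $\delta\in(0,1)$. 1. With probability at least $1-\delta$, both $\mathcal R(T)$ and $\mathcal R^{\mathrm{st}}(T)$ are at most $$\left(\frac\tau m+\frac{T-\tau}\tau\cdot\frac{e^{2\xi_{\max}m/R}\,R\log(2m/\delta)}{2m^2\xi_{\min}^2}\right)\sum_{i=1}^m\zeta_i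 .$$ 2. There is a choice of exploration horizons $\tau^\star(T)$, each an integer multiple of $\frac mR$, which depends only on $m,R,\xi_{\min},\xi_{\max},\delta$ and $T$, such that $\tau^\star(T)=\Theta(\sqrt T)$ and $0<\tau^\star(T)\le T$ for all large $T$, and such that for every $\zeta$ there is a constant $C$, depending only on $m,R,\xi_{\min},\xi_{\max},\delta,\zeta$, for which the following holds for all sufficiently large $T$ (uniformly in $\xi\in[\xi_{\min},\xi_{\max}]^m$): explore-and-commit with $\tau=\tau^\star(T)$ satisfies $\mathcal R(T)\le C\sqrt T$ and $\mathcal R^{\mathrm{st}}(T)\le C\sqrt T$ with probability at least $1-\delta$. -/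

import Mathlib

open MeasureTheory ProbabilityTheory Filter Asymptotics
open scoped NNReal ENNReal

noncomputable section

/-! ### Poisson processes -/

/-- Number of events up to time `t` of the point process with event times `x 0, x 1, …`. -/
def countUpTo {Ω : Type*} (x : ℕ → Ω → ℝ) (t : ℝ≥0) (ω : Ω) : ℕ :=
  {n | x n ω ≤ t}.ncard

/-- `x 0 < x 1 < …` are the event times of a homogeneous Poisson process on `(0, ∞)` with rate
`rate`: finitely many events in bounded time, independent increments, and the number of events in
`(s, t]` has the Poisson distribution with mean `rate * (t - s)`. -/
structure IsPoissonProcess {Ω : Type*} [MeasurableSpace Ω] (x : ℕ → Ω → ℝ) (rate : ℝ)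
    (μ : Measure Ω) : Prop where
  measurable : ∀ n, Measurable (x n)
  pos : ∀ n ω, 0 < x n ω
  strictMono : ∀ ω, StrictMono fun n => x n ω
  tendsto : ∀ ω, Tendsto (fun n => x n ω) atTop atTop
  indep : HasIndepIncrements (countUpTo x) μ
  law : ∀ s t : ℝ≥0, s ≤ t →
    HasLaw (fun ω => countUpTo x t ω - countUpTo x s ω)
      (poissonMeasure (rate * (t - s)).toNNReal) μ

/-! ### The crawling model -/

/-- The sources of randomness for `m` pages: `change i n` is the time of the `n`-th change of page
`i`, `request i n` the time of its `n`-th request, and `clock i` is the private randomness with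
which the crawler draws Poisson refresh times of page `i`. -/
structure CrawlProcesses (Ω : Type*) (m : ℕ) where
  change : Fin m → ℕ → Ω → ℝ
  request : Fin m → ℕ → Ω → ℝ
  clock : Fin m → ℕ → Ω → ℝ

/-- Changes and requests are Poisson processes with rates `ξ` and `ζ`, the clocks are Poisson
processes with rate `1`, and all these processes are mutually independent. -/
structure IsCrawlModel {Ω : Type*} [MeasurableSpace Ω] {m : ℕ} (P : CrawlProcesses Ω m)
    (ξ ζ : Fin m → ℝ) (μ : Measure Ω) : Prop where
  change : ∀ i, IsPoissonProcess (P.change i) (ξ i) μ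
  request : ∀ i, IsPoissonProcess (P.request i) (ζ i) μ
  clock : ∀ i, IsPoissonProcess (P.clock i) 1 μ
  indep : iIndepFun (Sum.elim (fun i ω n => P.change i n ω)
    (Sum.elim (fun i ω n => P.request i n ω) (fun i ω n => P.clock i n ω)) :
      Fin m ⊕ (Fin m ⊕ Fin m) → Ω → ℕ → ℝ) μ

/-- A page with set `X` of change times and set `Y` of refresh times is fresh at time `t` if its
last refresh before `t` is later than its last change before `t` (if any); it is not fresh if it
has never been refreshed before `t`. -/
def fresh (X Y : Set ℝ) (t : ℝ) : Prop :=
  ∃ y ∈ Y, y < t ∧ ∀ x ∈ X, x < t → x < y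

/-- The set of change times of page `i`. -/
def CrawlProcesses.changeTimes {Ω : Type*} {m : ℕ} (P : CrawlProcesses Ω m) (i : Fin m) (ω : Ω) :
    Set ℝ :=
  Set.range fun n => P.change i n ω

/-- Utility collected in `[t₁, t₂]` if page `i` is refreshed at the times in `Y i`: `1 / m` times
the number of requests in `[t₁, t₂]` that find a fresh page. -/
def utility {Ω : Type*} {m : ℕ} (P : CrawlProcesses Ω m) (Y : Fin m → Set ℝ) (t₁ t₂ : ℝ) (ω : Ω) :
    ℝ :=
  1 / (m : ℝ) * ∑ i, ({n | P.request i n ω ∈ Set.Icc t₁ t₂ ∧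
    fresh (P.changeTimes i ω) (Y i) (P.request i n ω)}.ncard : ℝ)

/-! ### Poisson refresh policies -/

/-- The policy class of nonnegative refresh rates with total rate `R`. -/
def ratePolicies (m : ℕ) (R : ℝ) : Set (Fin m → ℝ) :=
  {ρ | (∀ i, 0 ≤ ρ i) ∧ ∑ i, ρ i = R}

/-- Refresh times of a Poisson policy with rate `r ≥ 0` that starts at time `t₀`: the points
`t₀ + c n / r`, where `c` are the event times of a rate-`1` Poisson process. If `r = 0` there are
no refreshes (as `c n > 0`). -/
def poissonRefresh (c : ℕ → ℝ) (t₀ r : ℝ) : Set ℝ :=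
  {y | ∃ n, r * (y - t₀) = c n}

/-- The refresh times of all pages under the policy `ρ`, started at time `0`. -/
def rateSchedule {Ω : Type*} {m : ℕ} (P : CrawlProcesses Ω m) (ρ : Fin m → ℝ) (ω : Ω) :
    Fin m → Set ℝ :=
  fun i => poissonRefresh (fun n => P.clock i n ω) 0 (ρ i)

/-- The stationary (differential) utility `F(ρ; ξ) = ∑ ζ i ρ i / (ρ i + ξ i)`. -/
def statUtility {m : ℕ} (ζ ρ ξ : Fin m → ℝ) : ℝ :=
  ∑ i, ρ i * ζ i / (ρ i + ξ i)

/-- `ρ` maximizes `F(·; ξ)` over the policy class. -/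
def IsOptimalRate {m : ℕ} (R : ℝ) (ζ ξ ρ : Fin m → ℝ) : Prop :=
  ρ ∈ ratePolicies m R ∧ IsMaxOn (fun ρ' => statUtility ζ ρ' ξ) (ratePolicies m R) ρ

/-- `argmax` of `F(·; ξ)` over the policy class. -/
def optimalRate {m : ℕ} (R : ℝ) (ζ ξ : Fin m → ℝ) : Fin m → ℝ :=
  Classical.epsilon (IsOptimalRate R ζ ξ)

/-- The maximum exists. -/
theorem isOptimalRate_optimalRate {m : ℕ} (hm : 0 < m) {R : ℝ} (hR : 0 ≤ R) (ζ ξ : Fin m → ℝ)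
    (hξ : ∀ i, 0 < ξ i) : IsOptimalRate R ζ ξ (optimalRate R ζ ξ) := by
  apply Classical.epsilon_spec (p := IsOptimalRate R ζ ξ)
  have hne : (ratePolicies m R).Nonempty := by
    refine ⟨Pi.single ⟨0, hm⟩ R, fun i => ?_, by simp⟩
    by_cases h : i = ⟨0, hm⟩
    · subst h; simpa using hR
    · simp [h]
  have hclosed : IsClosed (ratePolicies m R) := by
    have : ratePolicies m R = (⋂ i, {ρ | 0 ≤ ρ i}) ∩ {ρ | ∑ i, ρ i = R} := by
      ext ρ; simp [ratePolicies]
    rw [this]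
    exact (isClosed_iInter fun i => isClosed_le continuous_const (continuous_apply i)).inter
      (isClosed_eq (by fun_prop) continuous_const)
  have hcomp : IsCompact (ratePolicies m R) := by
    refine (isCompact_Icc (a := (0 : Fin m → ℝ)) (b := fun _ => R)).of_isClosed_subset hclosed ?_
    rintro ρ ⟨h0, hs⟩
    refine ⟨h0, fun i => ?_⟩
    rw [← hs]
    exact Finset.single_le_sum (fun j _ => h0 j) (Finset.mem_univ i)
  have hcont : ContinuousOn (fun ρ' => statUtility ζ ρ' ξ) (ratePolicies m R) := by
    unfold statUtility
    refine continuousOn_finsetSum _ fun i _ => ContinuousOn.div (by fun_prop) (by fun_prop) ?_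
    intro ρ hρ
    have := hρ.1 i
    have := hξ i
    positivity
  obtain ⟨ρ, hρ, hmax⟩ := hcomp.exists_isMaxOn hne hcont
  exact ⟨ρ, hρ, hmax⟩

/-! ### Uniform-interval exploration and estimation -/

/-- Uniform-interval exploration for time `N * (m / R)`: refreshes at `0, m / R, …, N * (m / R)`. -/
def uniformRefresh (m : ℕ) (R : ℝ) (N : ℕ) : Set ℝ :=
  {y | ∃ k : ℕ, k ≤ N ∧ y = k * (m / R)}

/-- The single-bit feedback in the exploration phase: the refresh of page `i` at time
`(n + 1) * (m / R)` shows whether the cached copy was still fresh, i.e. whether the page has not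
changed since its previous refresh at time `n * (m / R)`. -/
def observation {Ω : Type*} {m : ℕ} (P : CrawlProcesses Ω m) (R : ℝ) (N : ℕ) (ω : Ω) :
    Fin m → Fin N → Prop :=
  fun i n => fresh (P.changeTimes i ω) (uniformRefresh m R N) (((n : ℕ) + 1) * (m / R))

/-- The fraction of the `N` exploration windows of page `i` in which no change was observed. -/
def noChangeFraction {Ω : Type*} {m : ℕ} (P : CrawlProcesses Ω m) (R : ℝ) (N : ℕ) (i : Fin m)
    (ω : Ω) : ℝ :=
  1 / (N : ℝ) * ({n | observation P R N ω i n}.ncard : ℝ)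

/-- `exp (-s w)`, with value `0` at `s = ∞`. -/
def expNeg (s : ℝ≥0∞) (w : ℝ) : ℝ :=
  if s = ∞ then 0 else Real.exp (-(s.toReal * w))

/-- `s` solves the moment matching equation `p = (1 / N) ∑ exp (-s (w n))`; the solution is `∞` for
`p = 0` and `0` for `p = 1`. -/
def IsMomentSolution {N : ℕ} (w : Fin N → ℝ) (p : ℝ) (s : ℝ≥0∞) : Prop :=
  p = 1 / (N : ℝ) * ∑ n, expNeg s (w n)

/-- The solution of the moment matching equation. -/
def momentSolution {N : ℕ} (w : Fin N → ℝ) (p : ℝ) : ℝ≥0∞ :=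
  Classical.epsilon (IsMomentSolution w p)

/-- The moment matching equation with equal windows has exactly one solution. -/
theorem existsUnique_isMomentSolution {N : ℕ} (hN : 0 < N) {c : ℝ} (hc : 0 < c) {p : ℝ}
    (hp : p ∈ Set.Icc (0 : ℝ) 1) :
    ∃! s, IsMomentSolution (fun _ : Fin N => c) p s := by
  have hN' : (N : ℝ) ≠ 0 := by positivity
  have key : ∀ s, IsMomentSolution (fun _ : Fin N => c) p s ↔ p = expNeg s c := by
    intro s
    simp [IsMomentSolution, hN']
  simp only [key]
  obtain h0 | h0 := hp.1.eq_or_lt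
  · refine ⟨∞, by simp [expNeg, ← h0], fun s hs => ?_⟩
    by_contra hne
    simp only [expNeg, hne, if_false] at hs
    exact (Real.exp_pos _).ne' (hs.symm.trans h0.symm)
  · have hl : 0 ≤ -Real.log p / c := div_nonneg (by simpa using Real.log_nonpos hp.1 hp.2) hc.le
    refine ⟨ENNReal.ofReal (-Real.log p / c), ?_, fun s hs => ?_⟩
    · simp only [expNeg, ENNReal.ofReal_ne_top, if_false, ENNReal.toReal_ofReal hl]
      rw [div_mul_cancel₀ _ hc.ne', neg_neg, Real.exp_log h0]
    · have hne : s ≠ ∞ := by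
        rintro rfl
        simp [expNeg] at hs
        exact h0.ne' hs
      simp only [expNeg, hne, if_false] at hs
      rw [hs, Real.log_exp, neg_neg, mul_div_cancel_right₀ _ hc.ne', ENNReal.ofReal_toReal hne]

/-- The estimate of the change rate of page `i`: the moment matching solution for the `N` windows
of length `m / R`, clipped to `[ξmin, ξmax]`. -/
def estimate {Ω : Type*} {m : ℕ} (P : CrawlProcesses Ω m) (R ξmin ξmax : ℝ) (N : ℕ) (ω : Ω)
    (i : Fin m) : ℝ :=
  max ξmin (min (ENNReal.ofReal ξmax)
    (momentSolution (fun _ : Fin N => (m : ℝ) / R) (noChangeFraction P R N i ω))).toReal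

/-! ### Explore-and-commit and its regret -/

/-- The rates that explore-and-commit uses after the exploration phase. -/
def commitRate {Ω : Type*} {m : ℕ} (P : CrawlProcesses Ω m) (R ξmin ξmax : ℝ) (ζ : Fin m → ℝ)
    (N : ℕ) (ω : Ω) : Fin m → ℝ :=
  optimalRate R ζ (estimate P R ξmin ξmax N ω)

/-- Refresh times of explore-and-commit with exploration time `τ = N * (m / R)`: uniform intervals
up to time `τ`, then the Poisson policy with rates `commitRate`, started at `τ`. -/
def etcSchedule {Ω : Type*} {m : ℕ} (P : CrawlProcesses Ω m) (R ξmin ξmax : ℝ) (ζ : Fin m → ℝ)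
    (N : ℕ) (ω : Ω) : Fin m → Set ℝ :=
  fun i => uniformRefresh m R N ∪
    poissonRefresh (fun n => P.clock i n ω) (N * (m / R)) (commitRate P R ξmin ξmax ζ N ω i)

/-- The information gathered in the exploration phase. -/
abbrev explorationInfo {Ω : Type*} {m : ℕ} (P : CrawlProcesses Ω m) (R : ℝ) (N : ℕ) :
    MeasurableSpace Ω :=
  MeasurableSpace.comap (observation P R N) inferInstance

/-- Expected regret of explore-and-commit up to time `T`, given the exploration phase: the best
expected utility of a Poisson policy minus the conditional expectation of the utility of
explore-and-commit given the observations of the exploration phase. -/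
def etcRegret {Ω : Type*} [MeasurableSpace Ω] {m : ℕ} (μ : Measure Ω) (P : CrawlProcesses Ω m)
    (R ξmin ξmax : ℝ) (ζ : Fin m → ℝ) (N : ℕ) (T : ℝ) (ω : Ω) : ℝ :=
  sSup ((fun ρ => ∫ ω', utility P (rateSchedule P ρ ω') 0 T ω' ∂μ) '' ratePolicies m R) -
    (μ[fun ω' => utility P (etcSchedule P R ξmin ξmax ζ N ω') 0 T ω' | explorationInfo P R N]) ω

/-- Regret of explore-and-commit in the stationary approximation, where a Poisson policy `ρ` earns
`F(ρ; ξ) / m` per unit of time; the exploration phase earns its exact expected utility. -/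
def etcStatRegret {Ω : Type*} [MeasurableSpace Ω] {m : ℕ} (μ : Measure Ω) (P : CrawlProcesses Ω m)
    (R ξmin ξmax : ℝ) (ζ ξ : Fin m → ℝ) (N : ℕ) (T : ℝ) (ω : Ω) : ℝ :=
  T / m * sSup ((fun ρ => statUtility ζ ρ ξ) '' ratePolicies m R) -
    (∫ ω', utility P (fun _ => uniformRefresh m R N) 0 (N * (m / R)) ω' ∂μ +
      (T - N * (m / R)) / m * statUtility ζ (commitRate P R ξmin ξmax ζ N ω) ξ)

end

/-! The proof has three ingredients.

The loss of the committed rates is quadratic in the estimation error. For one page, the gap between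
two rates at the true change rate exceeds its linearization, taken at the estimate and the committed
rate, by at most the squared error over `ξmin ^ 2` (`utility_gap_le`). Summed over the pages with
weights `ζ`, the linear terms are at most zero, because the committed rates are optimal for the
estimates (`IsOptimalRate.sum_gradient_le`). An error of order `1 / √N` therefore costs only order
`1 / N` per unit of time, which is what makes `√T` regret possible.

The estimates are accurate. The windows of a page are independent, each without a change with
probability `exp (-ξ m / R)`, so Hoeffding's inequality and a union bound over the pages control all
no-change fractions. Inverting the exponential on rates up to `ξmax` costs the factor `exp (2 ξmax m
/ R) (R / m) ^ 2` on squared errors (`clipped_momentSolution_sub_sq_le`).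

Replacing true by stationary utility costs nothing, since both errors have the right sign. Seen
backwards from time `t`, freshness is a race between the last refresh and the last change, which the
refresh wins with stationary probability `r / (r + ξ)`. Starting with an empty cache can only lower
this probability, and starting with a refresh at time `τ` can only raise it, also given the
observations, which are independent of what changes and clock do afterwards. Both bounds come from
`measureReal_inter_le_of_race`; Campbell's formula (`IsPoissonProcess.tsum_measure_mem_eq`) turns
them into bounds on expected utilities.

Hence, up to a null set, both regrets are at most `T / m` times the optimal `F` minus `(T - τ) / m`
times the `F` of the committed rates. The first `τ` units of time cost at most `τ / m * ∑ ζ`, the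
remaining ones the quadratic loss, and `τ` of order `√T` balances the two. -/

/-! ### Sensitivity of the optimal rates -/

/-- The gap between the suboptimality of the rate `b` in one page with change rate `x` and its
linearization at the change rate `y` is quadratic in `x - y`. -/
theorem utility_gap_le {a b x y l : ℝ} (ha : 0 ≤ a) (hb : 0 ≤ b) (hl : 0 < l) (hx : l ≤ x)
    (hy : l ≤ y) :
    a / (a + x) - b / (b + x) - y * (a - b) / (b + y) ^ 2 ≤ (x - y) ^ 2 / l ^ 2 := by
  have hx0 : 0 < x := hl.trans_le hx
  have hy0 : 0 < y := hl.trans_le hy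
  -- The worst `a` for the gap satisfies `√y (a + x) = √x (b + y)`. With square roots as variables,
  -- `h1` completes the square around it.
  obtain ⟨p, hp, rfl⟩ : ∃ p : ℝ, 0 < p ∧ x = p ^ 2 :=
    ⟨√x, by positivity, (Real.sq_sqrt hx0.le).symm⟩
  obtain ⟨q, hq, rfl⟩ : ∃ q : ℝ, 0 < q ∧ y = q ^ 2 :=
    ⟨√y, by positivity, (Real.sq_sqrt hy0.le).symm⟩
  have h1 : a / (a + p ^ 2) - b / (b + p ^ 2) - q ^ 2 * (a - b) / (b + q ^ 2) ^ 2 =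
      (p - q) ^ 2 * (b - p * q) ^ 2 / ((b + p ^ 2) * (b + q ^ 2) ^ 2) -
        (p * (b + q ^ 2) - q * (a + p ^ 2)) ^ 2 / ((a + p ^ 2) * (b + q ^ 2) ^ 2) := by
    field_simp
    ring
  have h2 : 0 ≤ (p * (b + q ^ 2) - q * (a + p ^ 2)) ^ 2 / ((a + p ^ 2) * (b + q ^ 2) ^ 2) := by
    positivity
  have h3 : (b - p * q) ^ 2 / ((b + p ^ 2) * (b + q ^ 2) ^ 2) ≤ (p + q) ^ 2 / l ^ 2 := by
    rw [div_le_div_iff₀ (by positivity) (by positivity)]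
    -- The difference of the two sides is `b (p + q) ^ 2`.
    have e1 : (b - p * q) ^ 2 ≤ (b + p ^ 2) * (b + q ^ 2) := by
      nlinarith [mul_pos hp hq, mul_nonneg hb (sq_nonneg (p + q)), mul_nonneg hb (mul_pos hp hq).le]
    have e2 : l ≤ (p + q) ^ 2 := by nlinarith [mul_pos hp hq]
    have e3 : l ≤ b + q ^ 2 := by linarith
    calc (b - p * q) ^ 2 * l ^ 2 = l * ((b - p * q) ^ 2 * l) := by ring
      _ ≤ (p + q) ^ 2 * ((b + p ^ 2) * (b + q ^ 2) * (b + q ^ 2)) := by gcongr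
      _ = _ := by ring
  calc _ ≤ (p - q) ^ 2 * ((b - p * q) ^ 2 / ((b + p ^ 2) * (b + q ^ 2) ^ 2)) := by
        rw [h1, ← mul_div_assoc]; linarith
    _ ≤ (p - q) ^ 2 * ((p + q) ^ 2 / l ^ 2) := by gcongr
    _ = _ := by ring

theorem convex_ratePolicies (m : ℕ) (R : ℝ) : Convex ℝ (ratePolicies m R) := by
  rintro a ⟨ha, hsa⟩ b ⟨hb, hsb⟩ s t hs ht hst
  refine ⟨fun i => ?_, ?_⟩
  · have := ha i
    have := hb i
    simp only [Pi.add_apply, Pi.smul_apply, smul_eq_mul]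
    positivity
  · simp [Finset.sum_add_distrib, ← Finset.mul_sum, hsa, hsb, ← add_mul, hst]

/-- First-order optimality condition. -/
theorem IsOptimalRate.sum_gradient_le {m : ℕ} {R : ℝ} {ζ y b : Fin m → ℝ}
    (hopt : IsOptimalRate R ζ y b) (hy : ∀ i, 0 < y i) {a : Fin m → ℝ} (ha : a ∈ ratePolicies m R) :
    ∑ i, ζ i * (y i * (a i - b i) / (b i + y i) ^ 2) ≤ 0 := by
  have hb := hopt.1
  -- The difference quotient of `F(·; y)` along the segment from `b` to `a`, with `t` cancelled, so
  -- that its value at `t = 0` is the directional derivative.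
  let g : ℝ → ℝ := fun t => ∑ i, ζ i * (y i * (a i - b i) /
    ((b i + t * (a i - b i) + y i) * (b i + y i)))
  have hpos : ∀ i, 0 < b i + y i := fun i => add_pos_of_nonneg_of_pos (hb.1 i) (hy i)
  have hg : ContinuousAt g 0 := by
    refine tendsto_finsetSum _ fun i _ => ?_
    have := (hpos i).ne'
    exact ContinuousAt.mul continuousAt_const
      (ContinuousAt.div (by fun_prop) (by fun_prop) (by simp [this]))
  have hle : ∀ t ∈ Set.Ioo (0 : ℝ) 1, g t ≤ 0 := by
    rintro t ⟨ht0, ht1⟩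
    have hc : b + t • (a - b) ∈ ratePolicies m R := by
      convert convex_ratePolicies m R hb ha (by linarith : 0 ≤ 1 - t) ht0.le (by ring) using 1
      ext i; simp; ring
    have h1 := hopt.2 hc
    simp only [Set.mem_ofPred_eq, statUtility] at h1
    have h2 : t * g t = ∑ i, (b + t • (a - b)) i * ζ i / ((b + t • (a - b)) i + y i) -
        ∑ i, b i * ζ i / (b i + y i) := by
      rw [← Finset.sum_sub_distrib, Finset.mul_sum]
      refine Finset.sum_congr rfl fun i _ => ?_
      have e1 := (hpos i).ne'
      have e2 : b i + t * (a i - b i) + y i ≠ 0 := by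
        have := hc.1 i
        simp only [Pi.add_apply, Pi.smul_apply, Pi.sub_apply, smul_eq_mul] at this
        have := hy i
        positivity
      simp only [Pi.add_apply, Pi.smul_apply, Pi.sub_apply, smul_eq_mul]
      field_simp
      ring
    by_contra! h
    have := mul_pos ht0 h
    linarith
  have hlim : Tendsto g (nhdsWithin 0 (Set.Ioi 0)) (nhds (g 0)) := hg.tendsto.mono_left inf_le_left
  have := le_of_tendsto hlim
    (eventually_of_mem (Ioo_mem_nhdsGT (zero_lt_one' ℝ)) hle)
  simpa [g, sq] using this

theorem statUtility_le_sum {m : ℕ} {R : ℝ} {ζ x a : Fin m → ℝ} (hζ : ∀ i, 0 < ζ i)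
    (hx : ∀ i, 0 < x i) (ha : a ∈ ratePolicies m R) : statUtility ζ a x ≤ ∑ i, ζ i := by
  refine Finset.sum_le_sum fun i _ => ?_
  have := ha.1 i
  have := hx i
  have := hζ i
  rw [div_le_iff₀ (by positivity)]
  nlinarith [mul_pos (hζ i) (hx i)]

/-- The rates that are optimal for the change rates `y` are nearly optimal for `x`. -/
theorem IsOptimalRate.statUtility_sub_le {m : ℕ} {R l ε : ℝ} {ζ x y a b : Fin m → ℝ}
    (hopt : IsOptimalRate R ζ y b) (ha : a ∈ ratePolicies m R) (hζ : ∀ i, 0 < ζ i) (hl : 0 < l)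
    (hx : ∀ i, l ≤ x i) (hy : ∀ i, l ≤ y i) (hxy : ∀ i, (x i - y i) ^ 2 ≤ ε) :
    statUtility ζ a x - statUtility ζ b x ≤ ε / l ^ 2 * ∑ i, ζ i := by
  have hgrad := hopt.sum_gradient_le (fun i => hl.trans_le (hy i)) ha
  have : ∀ i, a i * ζ i / (a i + x i) - b i * ζ i / (b i + x i) ≤
      ε / l ^ 2 * ζ i + ζ i * (y i * (a i - b i) / (b i + y i) ^ 2) := by
    intro i
    have h1 := utility_gap_le (ha.1 i) (hopt.1.1 i) hl (hx i) (hy i)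
    have h2 : (x i - y i) ^ 2 / l ^ 2 ≤ ε / l ^ 2 := by gcongr; exact hxy i
    have h3 := mul_le_mul_of_nonneg_left (h1.trans h2) (hζ i).le
    calc _ = ζ i * (a i / (a i + x i) - b i / (b i + x i) - y i * (a i - b i) / (b i + y i) ^ 2)
          + ζ i * (y i * (a i - b i) / (b i + y i) ^ 2) := by ring
      _ ≤ _ := by linarith
  calc _ = ∑ i, (a i * ζ i / (a i + x i) - b i * ζ i / (b i + x i)) := by
        simp [statUtility, Finset.sum_sub_distrib]
    _ ≤ ∑ i, (ε / l ^ 2 * ζ i + ζ i * (y i * (a i - b i) / (b i + y i) ^ 2)) :=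
        Finset.sum_le_sum fun i _ => this i
    _ ≤ _ := by rw [Finset.sum_add_distrib, ← Finset.mul_sum]; linarith

/-! ### Sensitivity of the moment estimator -/

theorem clip_sub_sq_le {x s l u : ℝ} (hx : x ∈ Set.Icc l u) :
    (x - max l (min u s)) ^ 2 ≤ (x - s) ^ 2 := by
  refine sq_le_sq.2 ?_
  obtain ⟨h1, h2⟩ := hx
  rcases le_total u s with h | h
  · rw [min_eq_left h, max_eq_right (by linarith), abs_of_nonpos (by linarith),
      abs_of_nonpos (by linarith)]
    linarith
  · rw [min_eq_right h]
    rcases le_total l s with h' | h'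
    · rw [max_eq_right h']
    · rw [max_eq_left h', abs_of_nonneg (by linarith), abs_of_nonneg (by linarith)]
      linarith

/-- On `[0, u]`, the map `x ↦ exp (-x c)` expands distances by at least `c * exp (-u c)`. -/
theorem mul_abs_sub_le_abs_exp_sub_exp {x y u c : ℝ} (hx : x ≤ u) (hy : y ≤ u) (hc : 0 < c) :
    c * Real.exp (-(u * c)) * |x - y| ≤ |Real.exp (-(x * c)) - Real.exp (-(y * c))| := by
  wlog h : x ≤ y generalizing x y
  · rw [abs_sub_comm, abs_sub_comm (Real.exp _)]
    exact this hy hx (le_of_not_ge h)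
  have h1 : Real.exp (-(y * c)) ≤ Real.exp (-(x * c)) := Real.exp_le_exp.2 (by nlinarith)
  rw [abs_of_nonpos (by linarith), abs_of_nonneg (by linarith)]
  have h2 : Real.exp (-(x * c)) = Real.exp (-(y * c)) * Real.exp ((y - x) * c) := by
    rw [← Real.exp_add]; ring_nf
  have h3 := Real.add_one_le_exp ((y - x) * c)
  have h4 : Real.exp (-(u * c)) ≤ Real.exp (-(y * c)) := Real.exp_le_exp.2 (by nlinarith)
  have h5 : 0 ≤ (y - x) * c := by nlinarith
  have h6 := Real.exp_pos (-(y * c))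
  rw [h2]
  nlinarith

/-- The clipped moment estimate inherits the accuracy of the no-change fraction. -/
theorem clipped_momentSolution_sub_sq_le {N : ℕ} (hN : 0 < N) {c : ℝ} (hc : 0 < c) {p : ℝ}
    (hp : p ∈ Set.Icc (0 : ℝ) 1) {x l u : ℝ} (hl : 0 < l) (hx : x ∈ Set.Icc l u) :
    (x - max l (min (ENNReal.ofReal u) (momentSolution (fun _ : Fin N => c) p)).toReal) ^ 2 ≤
      (p - Real.exp (-(x * c))) ^ 2 * (Real.exp (2 * (u * c)) / c ^ 2) := by
  have hs : IsMomentSolution (fun _ : Fin N => c) p (momentSolution (fun _ : Fin N => c) p) :=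
    Classical.epsilon_spec (existsUnique_isMomentSolution hN hc hp).exists
  have hN' : (N : ℝ) ≠ 0 := by positivity
  generalize momentSolution (fun _ : Fin N => c) p = s at hs
  have hps : p = expNeg s c := by simpa [IsMomentSolution, hN'] using hs
  have hu : 0 < u := hl.trans_le (hx.1.trans hx.2)
  set v := (min (ENNReal.ofReal u) s).toReal with hv
  have hvu : v ≤ u := by
    rw [hv]
    exact (ENNReal.toReal_mono ENNReal.ofReal_ne_top (min_le_left _ _)).trans_eq
      (ENNReal.toReal_ofReal hu.le)
  -- The solution `s` may be `∞`; the truncated `v` is a real number at most `u`, and clipping it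
  -- below at `l` does not move it away from `x`.
  have hclip : (x - max l v) ^ 2 ≤ (x - v) ^ 2 := by
    simpa [min_eq_right hvu] using clip_sub_sq_le (s := v) hx
  refine hclip.trans ?_
  have hexp : |Real.exp (-(x * c)) - Real.exp (-(v * c))| ≤ |p - Real.exp (-(x * c))| := by
    by_cases hsu : s ≤ ENNReal.ofReal u
    · have hst : s ≠ ∞ := ne_top_of_le_ne_top ENNReal.ofReal_ne_top hsu
      rw [abs_sub_comm, hps, expNeg, if_neg hst, hv, min_eq_right hsu]
    -- If the truncation is active, then `p ≤ exp (-u c) ≤ exp (-x c)`, so replacing `p` by `exp (-u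
    -- c)` only reduces the error.
    · have hvu' : v = u := by
        rw [hv, min_eq_left (le_of_not_ge hsu), ENNReal.toReal_ofReal hu.le]
      have h1 : p ≤ Real.exp (-(u * c)) := by
        rw [hps, expNeg]
        split_ifs with h
        · positivity
        · refine Real.exp_le_exp.2 ?_
          have := (ENNReal.ofReal_le_iff_le_toReal h).1 (le_of_not_ge hsu)
          nlinarith
      have h2 : Real.exp (-(u * c)) ≤ Real.exp (-(x * c)) :=
        Real.exp_le_exp.2 (by nlinarith [hx.2])
      rw [hvu', abs_of_nonneg (by linarith), abs_of_nonpos (by linarith)]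
      linarith
  have h1 := (mul_abs_sub_le_abs_exp_sub_exp hx.2 hvu hc).trans hexp
  have h2 := pow_le_pow_left₀ (by positivity) h1 2
  rw [sq_abs, mul_pow, sq_abs, mul_pow, ← Real.exp_nat_mul] at h2
  have h3 : Real.exp (2 * (u * c)) * Real.exp ((2 : ℕ) * -(u * c)) = 1 := by
    rw [← Real.exp_add]; simp
  rw [← mul_div_assoc, le_div_iff₀ (by positivity)]
  calc (x - v) ^ 2 * c ^ 2 = (c ^ 2 * Real.exp ((2 : ℕ) * -(u * c)) * (x - v) ^ 2) *
        Real.exp (2 * (u * c)) := by linear_combination (-(x - v) ^ 2 * c ^ 2) * h3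
    _ ≤ _ := by gcongr

/-! ### Elementary facts on Poisson processes -/

theorem lintegral_natCast_poissonMeasure (r : ℝ≥0) :
    ∫⁻ n : ℕ, (n : ℝ≥0∞) ∂(poissonMeasure r) = r := by
  have h : HasSum (fun n : ℕ => Real.exp (-r) * r ^ n / n.factorial * n) (r : ℝ) := by
    -- The term at zero vanishes, and the shifted series is `r` times the sum of the Poisson
    -- weights.
    rw [← hasSum_nat_add_iff' 1]
    have := (hasSum_one_poissonMeasure r).mul_left (r : ℝ)
    simp only [mul_one] at this
    simp only [Finset.range_one, Finset.sum_singleton, CharP.cast_eq_zero, mul_zero, sub_zero]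
    refine this.congr_fun ?_
    intro n
    rw [Nat.factorial_succ]
    push_cast
    field_simp
    ring
  rw [poissonMeasure, lintegral_sum_measure]
  simp only [lintegral_smul_measure, lintegral_dirac, smul_eq_mul]
  calc ∑' n : ℕ, ENNReal.ofReal (Real.exp (-r) * r ^ n / n.factorial) * (n : ℝ≥0∞)
      = ∑' n : ℕ, ENNReal.ofReal (Real.exp (-r) * r ^ n / n.factorial * n) := by
        congr with n
        rw [ENNReal.ofReal_mul (by positivity), ENNReal.ofReal_natCast]
    _ = ENNReal.ofReal r := by
        rw [← ENNReal.ofReal_tsum_of_nonneg (fun n => by positivity) h.summable, h.tsum_eq]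
    _ = r := ENNReal.ofReal_coe_nnreal

theorem natCast_ncard_eq_tsum {Ω : Type*} {Q : ℕ → Set Ω} {ω : Ω} (hfin : {n | ω ∈ Q n}.Finite) :
    ({n | ω ∈ Q n}.ncard : ℝ≥0∞) = ∑' n, (Q n).indicator 1 ω := by
  have : ∑' n, (Q n).indicator (1 : Ω → ℝ≥0∞) ω =
      ∑' n, {n | ω ∈ Q n}.indicator (1 : ℕ → ℝ≥0∞) n := by
    congr with n
  rw [this, ← tsum_subtype {n | ω ∈ Q n} (1 : ℕ → ℝ≥0∞)]
  simp only [Pi.one_apply, ENNReal.tsum_set_one]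
  rw [← hfin.cast_ncard_eq]
  rfl

section Poisson

variable {Ω : Type*} [MeasurableSpace Ω] {x : ℕ → Ω → ℝ} {rate : ℝ} {μ : Measure Ω}

namespace IsPoissonProcess

theorem finite_le (h : IsPoissonProcess x rate μ) (t : ℝ) (ω : Ω) : {n | x n ω ≤ t}.Finite := by
  have := (h.tendsto ω).eventually_gt_atTop t
  rw [← Nat.cofinite_eq_atTop, eventually_cofinite] at this
  simpa using this

theorem countUpTo_sub (h : IsPoissonProcess x rate μ) {s t : ℝ≥0} (hst : s ≤ t) (ω : Ω) :
    countUpTo x t ω - countUpTo x s ω = {n | x n ω ∈ Set.Ioc (s : ℝ) t}.ncard := by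
  have : {n | x n ω ∈ Set.Ioc (s : ℝ) t} = {n | x n ω ≤ t} \ {n | x n ω ≤ s} := by
    ext n; simp [and_comm]
  have hsub : {n | x n ω ≤ s} ⊆ {n | x n ω ≤ t} :=
    fun n (hn : x n ω ≤ s) => hn.trans (NNReal.coe_le_coe.2 hst)
  rw [this, Set.ncard_sdiff hsub (h.finite_le s ω), countUpTo, countUpTo]

theorem tsum_measure_Ioc (h : IsPoissonProcess x rate μ) {s t : ℝ≥0} (hst : s ≤ t) :
    ∑' n, μ (x n ⁻¹' Set.Ioc (s : ℝ) t) = ENNReal.ofReal (rate * (t - s)) := by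
  have h1 := (h.law s t hst).lintegral_comp (f := fun n : ℕ => (n : ℝ≥0∞))
    Measurable.of_discrete.aemeasurable
  rw [lintegral_natCast_poissonMeasure] at h1
  calc ∑' n, μ (x n ⁻¹' Set.Ioc (s : ℝ) t)
      = ∑' n, ∫⁻ ω, (x n ⁻¹' Set.Ioc (s : ℝ) t).indicator 1 ω ∂μ := by
        congr with n
        rw [lintegral_indicator_one (h.measurable n measurableSet_Ioc)]
    _ = ∫⁻ ω, ∑' n, (x n ⁻¹' Set.Ioc (s : ℝ) t).indicator 1 ω ∂μ := by
        rw [lintegral_tsum]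
        exact fun n => (measurable_one.indicator (h.measurable n measurableSet_Ioc)).aemeasurable
    _ = ∫⁻ ω, ((countUpTo x t ω - countUpTo x s ω : ℕ) : ℝ≥0∞) ∂μ := by
        congr with ω
        rw [h.countUpTo_sub hst]
        have hfin : {n | x n ω ∈ Set.Ioc (s : ℝ) t}.Finite :=
          (h.finite_le t ω).subset fun n hn => hn.2
        exact (natCast_ncard_eq_tsum (Q := fun n => x n ⁻¹' Set.Ioc (s : ℝ) t) hfin).symm
    _ = _ := by rw [h1]; rfl

/-- The intensity measure of a Poisson process. -/
theorem sum_map_eq (h : IsPoissonProcess x rate μ) (hrate : 0 ≤ rate) :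
    Measure.sum (fun n => μ.map (x n)) =
      ENNReal.ofReal rate • volume.restrict (Set.Ioi 0) := by
  have key : ∀ a b : ℝ, a < b → Measure.sum (fun n => μ.map (x n)) (Set.Ioc a b) =
      (ENNReal.ofReal rate • volume.restrict (Set.Ioi 0)) (Set.Ioc a b) := by
    intro a b hab
    -- The law of the counts is given only at nonnegative times; cutting at `0` loses nothing, as
    -- all events are positive.
    have e1 : Set.Ioc a b ∩ Set.Ioi 0 = Set.Ioc (a.toNNReal : ℝ) (b.toNNReal : ℝ) := by
      ext y
      simp only [Set.mem_inter_iff, Set.mem_Ioc, Set.mem_Ioi, Real.coe_toNNReal', max_lt_iff,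
        le_max_iff]
      grind
    rw [Measure.sum_apply _ measurableSet_Ioc, Measure.smul_apply,
      Measure.restrict_apply measurableSet_Ioc, e1, Real.volume_Ioc, smul_eq_mul,
      ← ENNReal.ofReal_mul hrate, ← h.tsum_measure_Ioc (Real.toNNReal_le_toNNReal hab.le)]
    congr with n
    rw [Measure.map_apply (h.measurable n) measurableSet_Ioc, ← e1]
    congr 1
    ext ω
    simp [h.pos n ω]
  refine Measure.ext_of_Ioc' _ _ (fun a b hab => ?_) fun a b hab => key a b hab
  rw [key a b hab, Measure.smul_apply, smul_eq_mul]
  exact ENNReal.mul_ne_top ENNReal.ofReal_ne_top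
    (ne_top_of_le_ne_top (by simp) (Measure.restrict_apply_le _ _))

/-- The intensity measure has no atoms. -/
theorem ae_ne (h : IsPoissonProcess x rate μ) (hrate : 0 ≤ rate) (t : ℝ) :
    ∀ᵐ ω ∂μ, ∀ n, x n ω ≠ t := by
  rw [ae_all_iff]
  intro n
  have h1 : Measure.sum (fun n => μ.map (x n)) {t} = 0 := by
    rw [h.sum_map_eq hrate, Measure.smul_apply]
    simp
  rw [Measure.sum_apply _ (measurableSet_singleton t), ENNReal.tsum_eq_zero] at h1
  have h2 := h1 n
  rw [Measure.map_apply (h.measurable n) (measurableSet_singleton t)] at h2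
  rw [ae_iff]
  simp only [ne_eq, not_not]
  exact h2

end IsPoissonProcess

/-- The event that the process `x` has no event in `[a, b)`. -/
def noEvent (x : ℕ → Ω → ℝ) (a b : ℝ) : Set Ω := {ω | ∀ n, x n ω ∉ Set.Ico a b}

theorem measurableSet_noEvent (hx : ∀ n, Measurable (x n)) (a b : ℝ) :
    MeasurableSet (noEvent x a b) := by
  have : noEvent x a b = ⋂ n, (x n ⁻¹' Set.Ico a b)ᶜ := by
    ext ω; simp [noEvent]
  rw [this]
  exact .iInter fun n => (hx n measurableSet_Ico).compl

/-- Freshness at `b` after a refresh at `a` concerns changes in `[a, b)`, whereas increments count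
events in `(a, b]`. The endpoints are almost surely not event times. -/
theorem IsPoissonProcess.noEvent_ae_iff (h : IsPoissonProcess x rate μ) (hrate : 0 ≤ rate)
    {a b : ℝ≥0} (hab : a ≤ b) :
    ∀ᵐ ω ∂μ, ω ∈ noEvent x a b ↔ countUpTo x b ω - countUpTo x a ω = 0 := by
  filter_upwards [h.ae_ne hrate a, h.ae_ne hrate b] with ω ha hb
  have hfin : {n | x n ω ∈ Set.Ioc (a : ℝ) b}.Finite := (h.finite_le b ω).subset fun n hn => hn.2
  rw [h.countUpTo_sub hab, Set.ncard_eq_zero hfin, Set.eq_empty_iff_forall_notMem]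
  refine forall_congr' fun n => not_congr ⟨fun hn => ⟨?_, hn.2.le⟩, fun hn => ⟨hn.1.le, ?_⟩⟩
  · exact lt_of_le_of_ne hn.1 (ha n).symm
  · exact lt_of_le_of_ne hn.2 (hb n)

theorem IsPoissonProcess.measureReal_noEvent (h : IsPoissonProcess x rate μ) (hrate : 0 ≤ rate)
    {a b : ℝ} (ha : 0 ≤ a) (hab : a ≤ b) :
    μ.real (noEvent x a b) = Real.exp (-(rate * (b - a))) := by
  lift a to ℝ≥0 using ha
  lift b to ℝ≥0 using a.2.trans hab
  have hab' : a ≤ b := by exact_mod_cast hab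
  have h1 : μ (noEvent x a b) = poissonMeasure (rate * (b - a)).toNNReal {0} := by
    rw [← (h.law a b hab').map_eq, Measure.map_apply_of_aemeasurable (h.law a b hab').aemeasurable
      (measurableSet_singleton 0)]
    exact measure_congr (eventuallyEq_set.2 (h.noEvent_ae_iff hrate hab'))
  rw [measureReal_def, h1, ← measureReal_def, poissonMeasure_real_singleton,
    Real.coe_toNNReal _ (mul_nonneg hrate (by linarith))]
  simp

/-- Absence of events in successive windows is independent. -/
theorem IsPoissonProcess.iIndepFun_noEvent (h : IsPoissonProcess x rate μ) (hrate : 0 ≤ rate)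
    {t : ℕ → ℝ≥0} (ht : Monotone t) :
    iIndepFun (fun n ω => ω ∈ noEvent x (t n) (t (n + 1))) μ := by
  have h1 := (h.indep.nat ht).comp (fun _ k => k = 0) fun _ => Measurable.of_discrete
  refine h1.congr fun n => ?_
  filter_upwards [h.noEvent_ae_iff hrate (ht n.le_succ)] with ω hω
  exact propext hω.symm

end Poisson

/-! ### Which of two independent processes had the last event -/

theorem le_one_sub_exp_neg_mul (z : ℝ) : z ≤ (1 - Real.exp (-z)) * (1 + z) := by
  have h1 := Real.add_one_le_exp z
  have h2 : Real.exp (-z) * Real.exp z = 1 := by rw [← Real.exp_add]; simp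
  have h3 := Real.exp_pos (-z)
  nlinarith

/-- Let `U s` and `V s` be the events that two independent processes, of rates `a` and `b`, have had
no event during the last time span `s`. If `B` is an event on which the first process has an event
and the second has none after it, then `B` has probability at most `a / (a + b)`,
conditionally on `E`. -/
theorem measureReal_inter_le_of_race {Ω : Type*} [MeasurableSpace Ω] {μ : Measure Ω}
    [IsProbabilityMeasure μ] {E B : Set Ω} {U V : ℝ → Set Ω} {a b D : ℝ} (ha : 0 ≤ a) (hb : 0 ≤ b)
    (hab : 0 < a + b) (hD : 0 ≤ D) (hU0 : ∀ ω, ω ∈ U 0) (hUD : ∀ ω ∈ B, ω ∉ U D)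
    (hUV : ∀ ω ∈ B, ∀ s ∈ Set.Icc 0 D, ω ∈ U s → ω ∈ V s) (hanti : Antitone U)
    (hE : MeasurableSet E) (hU : ∀ s, MeasurableSet (U s)) (hV : ∀ s, MeasurableSet (V s))
    (hP : ∀ s ∈ Set.Icc 0 D, ∀ s' ∈ Set.Icc 0 D,
      μ.real (E ∩ U s ∩ V s') = μ.real E * Real.exp (-(a * s)) * Real.exp (-(b * s'))) :
    μ.real (E ∩ B) ≤ μ.real E * (a / (a + b)) := by
  obtain rfl | hD := hD.eq_or_lt
  · have : B = ∅ := Set.eq_empty_of_forall_notMem fun ω hω => hUD ω hω (hU0 ω)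
    simp only [this, Set.inter_empty, measureReal_empty]
    positivity
  -- The probability should be `∫ a exp (-(a + b) s) ds`, over the age `s` of the last event of the
  -- first process. A grid of `K + 1` cells gives this bound up to a factor that tends to `1`,
  -- without a density.
  have key : ∀ K : ℕ, μ.real (E ∩ B) ≤
      μ.real E * (a / (a + b)) * (1 + (a + b) * (D / (K + 1 : ℕ))) := by
    intro K
    set h := D / (K + 1 : ℕ) with hh
    have hpos : 0 < h := by positivity
    have hKD : (K + 1 : ℕ) * h = D := by rw [hh]; field_simp
    -- The cell `j` is the one in which the first process, going backwards, has its first event. On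
    -- `B` the second process has then been silent for at least `j h`.
    have hcover : E ∩ B ⊆ ⋃ j ∈ Finset.range (K + 1),
        (E ∩ U (j * h) ∩ V (j * h)) \ (E ∩ U ((j + 1 : ℕ) * h) ∩ V (j * h)) := by
      rintro ω ⟨hωE, hωB⟩
      have hex : ∃ j : ℕ, ω ∉ U (j * h) := ⟨K + 1, by rw [hKD]; exact hUD ω hωB⟩
      classical
      obtain ⟨j, hj⟩ : ∃ j, Nat.find hex = j + 1 := Nat.exists_eq_succ_of_ne_zero (by
        intro h0
        have := Nat.find_spec hex
        rw [h0] at this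
        simp [hU0] at this)
      have h1 : ω ∉ U ((j + 1 : ℕ) * h) := hj ▸ Nat.find_spec hex
      have h2 : ω ∈ U (j * h) := not_not.1 (Nat.find_min hex (m := j) (by omega))
      have h3 : j + 1 ≤ K + 1 := hj ▸ Nat.find_min' hex (by rw [hKD]; exact hUD ω hωB)
      have h4 : (j : ℝ) * h ∈ Set.Icc 0 D := by
        refine ⟨by positivity, ?_⟩
        rw [← hKD]
        have : (j : ℝ) ≤ (K + 1 : ℕ) := by exact_mod_cast (by omega)
        gcongr
      simp only [Set.mem_iUnion, Finset.mem_range]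
      exact ⟨j, by omega, ⟨⟨hωE, h2⟩, hUV ω hωB _ h4 h2⟩, fun h5 => h1 h5.1.2⟩
    have hpiece : ∀ j ∈ Finset.range (K + 1),
        μ.real ((E ∩ U (j * h) ∩ V (j * h)) \ (E ∩ U ((j + 1 : ℕ) * h) ∩ V (j * h))) =
          μ.real E * (1 - Real.exp (-(a * h))) * Real.exp (-((a + b) * h)) ^ j := by
      intro j hj
      have hj' := Finset.mem_range.1 hj
      have hmem : ∀ k : ℕ, k ≤ K + 1 → (k : ℝ) * h ∈ Set.Icc 0 D := fun k hk => by
        refine ⟨by positivity, ?_⟩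
        rw [← hKD]
        have : (k : ℝ) ≤ (K + 1 : ℕ) := by exact_mod_cast hk
        gcongr
      rw [measureReal_sdiff _ ((hE.inter (hU _)).inter (hV _)),
        hP _ (hmem j (by omega)) _ (hmem j (by omega)),
        hP _ (hmem (j + 1) (by omega)) _ (hmem j (by omega))]
      · have e1 : Real.exp (-(a * ((j + 1 : ℕ) * h))) =
            Real.exp (-(a * (j * h))) * Real.exp (-(a * h)) := by
          rw [← Real.exp_add]; push_cast; ring_nf
        have e2 : Real.exp (-((a + b) * h)) ^ j =
            Real.exp (-(a * (j * h))) * Real.exp (-(b * (j * h))) := by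
          rw [← Real.exp_nat_mul, ← Real.exp_add]; ring_nf
        rw [e1, e2]; ring
      · gcongr
        apply hanti
        push_cast
        nlinarith
    have hq1 : Real.exp (-((a + b) * h)) < 1 := Real.exp_lt_one_iff.2 (by nlinarith)
    have hgeom : ∑ j ∈ Finset.range (K + 1), Real.exp (-((a + b) * h)) ^ j ≤
        (1 - Real.exp (-((a + b) * h)))⁻¹ := by
      rw [← tsum_geometric_of_lt_one (Real.exp_pos _).le hq1]
      exact (summable_geometric_of_lt_one (Real.exp_pos _).le hq1).sum_le_tsum _
        (fun _ _ => by positivity)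
    have h5 : 1 - Real.exp (-(a * h)) ≤ a * h := by
      have := Real.add_one_le_exp (-(a * h)); linarith
    have h5' : 0 ≤ 1 - Real.exp (-(a * h)) := by
      have : Real.exp (-(a * h)) ≤ 1 := Real.exp_le_one_iff.2 (by nlinarith)
      linarith
    -- Here `(1 + z) exp (-z) ≤ 1` is used with `z = (a + b) h`.
    have h6 : (1 - Real.exp (-((a + b) * h)))⁻¹ ≤ (1 + (a + b) * h) / ((a + b) * h) := by
      rw [inv_eq_one_div, div_le_div_iff₀ (by linarith) (by positivity), one_mul]
      have := le_one_sub_exp_neg_mul ((a + b) * h)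
      linarith
    calc μ.real (E ∩ B) ≤ μ.real (⋃ j ∈ Finset.range (K + 1),
          (E ∩ U (j * h) ∩ V (j * h)) \ (E ∩ U ((j + 1 : ℕ) * h) ∩ V (j * h))) :=
          measureReal_mono hcover (measure_ne_top _ _)
      _ ≤ ∑ j ∈ Finset.range (K + 1),
          μ.real ((E ∩ U (j * h) ∩ V (j * h)) \ (E ∩ U ((j + 1 : ℕ) * h) ∩ V (j * h))) :=
          measureReal_biUnion_finset_le _ _
      _ = μ.real E * (1 - Real.exp (-(a * h))) *
          ∑ j ∈ Finset.range (K + 1), Real.exp (-((a + b) * h)) ^ j := by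
          rw [Finset.sum_congr rfl hpiece, Finset.mul_sum]
      _ ≤ μ.real E * (a * h) * ((1 + (a + b) * h) / ((a + b) * h)) := by
          gcongr
          exact hgeom.trans h6
      _ = _ := by field_simp
  have hlim : Tendsto (fun K : ℕ => μ.real E * (a / (a + b)) * (1 + (a + b) * (D / (K + 1 : ℕ))))
      atTop (nhds (μ.real E * (a / (a + b)) * (1 + (a + b) * 0))) := by
    refine Tendsto.const_mul _ (Tendsto.const_add _ (Tendsto.const_mul _ ?_))
    exact (tendsto_const_div_atTop_nhds_zero_nat D).comp (tendsto_add_atTop_nat 1)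
  have := ge_of_tendsto' hlim key
  simpa using this

/-! ### Independence in the crawling model -/

section Model

variable {Ω : Type*} {m : ℕ} {P : CrawlProcesses Ω m} {ξ ζ : Fin m → ℝ}

/-- The feedback of a window tells whether the page has changed in it. -/
theorem observation_iff_mem_noEvent {R : ℝ} (hm : 0 < m) (hR : 0 < R) {N : ℕ} (ω : Ω) (i : Fin m)
    (n : Fin N) :
    observation P R N ω i n ↔
      ω ∈ noEvent (P.change i) (n * (m / R)) (((n : ℕ) + 1) * (m / R)) := by
  have hw : 0 < (m : ℝ) / R := by positivity
  simp only [observation, fresh, uniformRefresh, CrawlProcesses.changeTimes, noEvent,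
    Set.mem_ofPred_eq, Set.forall_mem_range, Set.mem_Ico, not_and, not_lt]
  constructor
  · rintro ⟨y, ⟨k, hk, rfl⟩, hlt, hall⟩ j hj
    by_contra! h
    have h1 := hall j h
    have h2 : (k : ℝ) < (n : ℕ) + 1 := lt_of_mul_lt_mul_right hlt hw.le
    have h3 : k ≤ (n : ℕ) := by
      have : k < (n : ℕ) + 1 := by exact_mod_cast h2
      omega
    have h4 : (k : ℝ) * (m / R) ≤ (n : ℕ) * (m / R) := by gcongr
    linarith
  · intro h
    refine ⟨(n : ℕ) * (m / R), ⟨n, n.2.le, rfl⟩, by linarith, fun j hj => ?_⟩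
    by_contra! h'
    linarith [h j h']

theorem observation_eq_iff {R : ℝ} {N : ℕ} (o : Fin m → Fin N → Prop) (ω : Ω) :
    observation P R N ω = o ↔ ∀ j n, observation P R N ω j n ↔ o j n := by
  simp [funext_iff]

theorem noEvent_comap_measurable (x : ℕ → Ω → ℝ) (a b : ℝ) :
    MeasurableSet[MeasurableSpace.comap (fun ω n => x n ω) inferInstance] (noEvent x a b) :=
  ⟨noEvent (fun n (X : ℕ → ℝ) => X n) a b, measurableSet_noEvent measurable_pi_apply a b, rfl⟩

variable [MeasurableSpace Ω] {μ : Measure Ω}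

theorem IsCrawlModel.measurable_change (h : IsCrawlModel P ξ ζ μ) (i : Fin m) :
    Measurable fun ω n => P.change i n ω :=
  measurable_pi_lambda _ (h.change i).measurable

theorem IsCrawlModel.measurable_request (h : IsCrawlModel P ξ ζ μ) (i : Fin m) :
    Measurable fun ω n => P.request i n ω :=
  measurable_pi_lambda _ (h.request i).measurable

theorem IsCrawlModel.measurable_clock (h : IsCrawlModel P ξ ζ μ) (i : Fin m) :
    Measurable fun ω n => P.clock i n ω :=
  measurable_pi_lambda _ (h.clock i).measurable

theorem IsCrawlModel.measurableSet_observation (h : IsCrawlModel P ξ ζ μ) (hm : 0 < m) {R : ℝ}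
    (hR : 0 < R) {N : ℕ} (i : Fin m) (n : Fin N) : MeasurableSet {ω | observation P R N ω i n} := by
  simp only [observation_iff_mem_noEvent hm hR]
  exact measurableSet_noEvent (h.change i).measurable _ _

theorem IsCrawlModel.measurable_observation (h : IsCrawlModel P ξ ζ μ) (hm : 0 < m) {R : ℝ}
    (hR : 0 < R) (N : ℕ) : Measurable (observation P R N) :=
  measurable_pi_lambda _ fun i => measurable_pi_lambda _ fun n =>
    measurableSet_setOfPred.1 (h.measurableSet_observation hm hR i n)

/-- Exploration windows of a page are independent of each other. -/
theorem IsCrawlModel.iIndepFun_observation (h : IsCrawlModel P ξ ζ μ) (hm : 0 < m) {R : ℝ}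
    (hR : 0 < R) (hξ : ∀ i, 0 < ξ i) {N : ℕ} (i : Fin m) :
    iIndepFun (fun (n : Fin N) ω => observation P R N ω i n) μ := by
  have hw : 0 < (m : ℝ) / R := by positivity
  obtain ⟨w, hw'⟩ : ∃ w : ℝ≥0, (w : ℝ) = m / R := CanLift.prf _ hw.le
  let t : ℕ → ℝ≥0 := fun n => n * w
  have ht : Monotone t := fun a b hab => by
    simp only [t]
    gcongr
  have h1 := ((h.change i).iIndepFun_noEvent (hξ i).le ht).precomp
    (g := fun n : Fin N => (n : ℕ)) Fin.val_injective
  convert h1 using 3 with n ω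
  rw [observation_iff_mem_noEvent hm hR]
  simp [t, hw']

/-- The exploration phase of a page is independent of its changes after the exploration phase. -/
theorem IsCrawlModel.measure_observation_inter_noEvent (h : IsCrawlModel P ξ ζ μ) (hm : 0 < m)
    {R : ℝ} (hR : 0 < R) (hξ : ∀ i, 0 < ξ i) {N : ℕ} (i : Fin m) (o : Fin N → Prop) {a b : ℝ}
    (ha : N * (m / R) ≤ a) (hab : a ≤ b) :
    μ ({ω | ∀ n, observation P R N ω i n ↔ o n} ∩ noEvent (P.change i) a b) =
      μ {ω | ∀ n, observation P R N ω i n ↔ o n} * μ (noEvent (P.change i) a b) := by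
  have hw : 0 < (m : ℝ) / R := by positivity
  have ha0 : 0 ≤ a := le_trans (by positivity) ha
  obtain ⟨w, hw'⟩ : ∃ w : ℝ≥0, (w : ℝ) = m / R := CanLift.prf _ hw.le
  lift b to ℝ≥0 using ha0.trans hab
  lift a to ℝ≥0 using ha0
  -- The windows `0, …, N - 1` are those of the exploration, window `N` is the possibly empty gap up
  -- to `a`, and window `N + 1` is `[a, b)`.
  let t : ℕ → ℝ≥0 := fun n => if n ≤ N then n * w else if n = N + 1 then a else b
  have ht : Monotone t := by
    refine monotone_nat_of_le_succ fun n => ?_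
    rw [← NNReal.coe_le_coe]
    rcases lt_trichotomy n N with hn | rfl | hn
    · simp only [t, if_pos hn.le, if_pos (Nat.succ_le_of_lt hn)]
      push_cast
      nlinarith [w.2]
    · simpa [t, hw'] using ha
    · rcases Nat.lt_or_ge (N + 1) n with hn' | hn'
      · have e1 : ¬ n ≤ N := by omega
        have e2 : n ≠ N + 1 := by omega
        have e3 : ¬ n + 1 ≤ N := by omega
        have e4 : n ≠ N := by omega
        simp [t, e1, e2, e3, e4]
      · obtain rfl : n = N + 1 := by omega
        have e3 : ¬ N + 1 + 1 ≤ N := by omega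
        simpa [t, e3] using hab
  have hind := (h.change i).iIndepFun_noEvent (hξ i).le ht
  have hmeas : ∀ n, Measurable fun ω => ω ∈ noEvent (P.change i) (t n) (t (n + 1)) :=
    fun n => measurableSet_setOfPred.1 (measurableSet_noEvent (h.change i).measurable _ _)
  have h2 := hind.indepFun_finset (Finset.range N) {N + 1} (by simp) hmeas
  have h3 := h2.measure_inter_preimage_eq_mul
    {f | ∀ n : Finset.range N, f n ↔ o ⟨n, Finset.mem_range.1 n.2⟩}
    {f | f ⟨N + 1, by simp⟩} (MeasurableSet.of_discrete) (MeasurableSet.of_discrete)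
  have e1 : {ω | ∀ n, observation P R N ω i n ↔ o n} =
      (fun ω (n : Finset.range N) => ω ∈ noEvent (P.change i) (t n) (t (n + 1))) ⁻¹'
        {f | ∀ n : Finset.range N, f n ↔ o ⟨n, Finset.mem_range.1 n.2⟩} := by
    ext ω
    simp only [observation_iff_mem_noEvent hm hR, Set.mem_ofPred_eq, Set.mem_preimage]
    have : ∀ n : Fin N, (t n : ℝ) = n * (m / R) ∧ (t (n + 1) : ℝ) = ((n : ℕ) + 1) * (m / R) := by
      intro n
      simp only [t, if_pos n.2.le, if_pos (Nat.succ_le_of_lt n.2)]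
      push_cast
      simp [hw']
    constructor
    · rintro hω ⟨n, hn⟩
      have := this ⟨n, Finset.mem_range.1 hn⟩
      simp only at this
      rw [this.1, this.2]
      exact hω ⟨n, Finset.mem_range.1 hn⟩
    · intro hω n
      rw [← (this n).1, ← (this n).2]
      exact hω ⟨n, Finset.mem_range.2 n.2⟩
  have e2 : noEvent (P.change i) a b =
      (fun ω (n : ({N + 1} : Finset ℕ)) => ω ∈ noEvent (P.change i) (t n) (t (n + 1))) ⁻¹'
        {f | f ⟨N + 1, by simp⟩} := by
    ext ω
    simp [t]
  rw [e1, e2]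
  exact h3

/-- The exploration phase, the later changes of a page and its clock are independent. -/
theorem IsCrawlModel.measureReal_observation_inter (h : IsCrawlModel P ξ ζ μ)
    [IsProbabilityMeasure μ] (hm : 0 < m)
    {R : ℝ} (hR : 0 < R) (hξ : ∀ i, 0 < ξ i) {N : ℕ} (i : Fin m) (o : Fin m → Fin N → Prop)
    {a b c d : ℝ} (ha : N * (m / R) ≤ a) (hab : a ≤ b) (hc : 0 ≤ c) (hcd : c ≤ d) :
    μ.real ({ω | observation P R N ω = o} ∩ noEvent (P.change i) a b ∩ noEvent (P.clock i) c d) =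
      μ.real {ω | observation P R N ω = o} * Real.exp (-(ξ i * (b - a))) * Real.exp (-(d - c)) := by
  have ha0 : 0 ≤ a := le_trans (by positivity) ha
  let Eo : Fin m → Set Ω := fun j => {ω | ∀ n, observation P R N ω j n ↔ o j n}
  have hEo : ∀ j, MeasurableSet[MeasurableSpace.comap (fun ω n => P.change j n ω) inferInstance]
      (Eo j) := by
    intro j
    simp only [Eo, observation_iff_mem_noEvent hm hR, Set.ofPred_forall]
    refine MeasurableSet.iInter fun n => ?_
    have h1 := noEvent_comap_measurable (P.change j) ((n : ℕ) * (m / R)) (((n : ℕ) + 1) * (m / R))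
    by_cases hn : o j n
    · simp only [hn, iff_true]
      exact h1
    · simp only [hn, iff_false]
      exact h1.compl
  have hE : {ω | observation P R N ω = o} = ⋂ j, Eo j := by
    ext ω
    simp only [observation_eq_iff, Set.mem_iInter, Set.mem_ofPred_eq, Eo]
  -- One event for each source of randomness. Independence across sources leaves a single
  -- intersection within one process, that of page `i`, which is handled by independent increments.
  let s : Fin m ⊕ (Fin m ⊕ Fin m) → Set Ω :=
    Sum.elim (fun j => if j = i then Eo j ∩ noEvent (P.change i) a b else Eo j)
      (Sum.elim (fun _ => Set.univ) (fun j => if j = i then noEvent (P.clock i) c d else Set.univ))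
  have hs := h.indep.meas_iInter (s := s) (by
    rintro (j | j | j)
    · by_cases hj : j = i
      · subst hj
        have e : s (Sum.inl j) = Eo j ∩ noEvent (P.change j) a b := by simp [s]
        rw [e]
        exact (hEo j).inter (noEvent_comap_measurable (P.change j) a b)
      · have e : s (Sum.inl j) = Eo j := by simp [s, hj]
        rw [e]
        exact hEo j
    · exact MeasurableSet.univ
    · by_cases hj : j = i
      · subst hj
        have e : s (Sum.inr (Sum.inr j)) = noEvent (P.clock j) c d := by simp [s]
        rw [e]
        exact noEvent_comap_measurable (P.clock j) c d
      · simp [s, hj])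
  have hE' : μ (⋂ j, Eo j) = ∏ j, μ (Eo j) :=
    (h.indep.precomp (g := Sum.inl) Sum.inl_injective).meas_iInter hEo
  have hsE : {ω | observation P R N ω = o} ∩ noEvent (P.change i) a b ∩ noEvent (P.clock i) c d =
      ⋂ k, s k := by
    rw [hE]
    ext ω
    simp only [Set.mem_inter_iff, Set.mem_iInter, Sum.forall, s, Sum.elim_inl, Sum.elim_inr,
      Set.mem_univ, implies_true, true_and]
    constructor
    · rintro ⟨⟨h1, h2⟩, h3⟩
      refine ⟨fun j => ?_, fun j => ?_⟩ <;> split_ifs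
      exacts [⟨h1 j, h2⟩, h1 j, h3, trivial]
    · rintro ⟨h1, h3⟩
      have h1i := h1 i
      have h3i := h3 i
      simp only [if_true] at h1i h3i
      refine ⟨⟨fun j => ?_, h1i.2⟩, h3i⟩
      have := h1 j
      split_ifs at this
      exacts [this.1, this]
  have hprod : μ (⋂ k, s k) = μ (⋂ j, Eo j) * μ (noEvent (P.change i) a b) *
      μ (noEvent (P.clock i) c d) := by
    rw [hs, Fintype.prod_sum_type, Fintype.prod_sum_type, hE']
    have e1 : ∀ j, μ (s (Sum.inl j)) =
        μ (Eo j) * if j = i then μ (noEvent (P.change i) a b) else 1 := by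
      intro j
      by_cases hj : j = i
      · subst hj
        simpa [s] using h.measure_observation_inter_noEvent hm hR hξ j (o j) ha hab
      · simp [s, hj]
    have e2 : ∀ j, μ (s (Sum.inr (Sum.inr j))) =
        if j = i then μ (noEvent (P.clock i) c d) else 1 := by
      intro j
      by_cases hj : j = i
      · simp [s, hj]
      · simp [s, hj]
    simp only [e1, e2, Finset.prod_mul_distrib, Finset.prod_ite_eq', Finset.mem_univ, if_true]
    simp [s]
  rw [hsE, measureReal_def, hprod, ENNReal.toReal_mul, ENNReal.toReal_mul, ← measureReal_def,
    ← measureReal_def, ← measureReal_def, ← hE, (h.change i).measureReal_noEvent (hξ i).le ha0 hab,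
    (h.clock i).measureReal_noEvent zero_le_one hc hcd, one_mul]

end Model

/-! ### Freshness under a Poisson policy -/

/-- Refreshes at the times in `A`, and in addition at rate `r` from time `t₀` on. -/
def mixedRefresh (A : Set ℝ) (c : ℕ → ℝ) (t₀ r : ℝ) : Set ℝ :=
  A ∪ {y | 0 < r ∧ ∃ n, y = t₀ + c n / r}

/-- The explicit form `t₀ + c n / r` makes measurability visible. At `r = 0`, where this form would
produce the point `t₀`, positivity of the clock times rules out refreshes. -/
theorem union_poissonRefresh_eq (A : Set ℝ) {c : ℕ → ℝ} (hc : ∀ n, 0 < c n) (t₀ : ℝ) {r : ℝ}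
    (hr : 0 ≤ r) : A ∪ poissonRefresh c t₀ r = mixedRefresh A c t₀ r := by
  unfold mixedRefresh poissonRefresh
  congr 1
  ext y
  obtain rfl | hr := hr.eq_or_lt
  · simp [fun n => (hc n).ne]
  · simp only [Set.mem_ofPred_eq, hr, true_and]
    refine exists_congr fun n => ?_
    rw [← sub_eq_iff_eq_add', eq_div_iff hr.ne', mul_comm]

/-- A general space and a variable time are needed because Campbell's formula requires joint
measurability in time and randomness. -/
theorem measurableSet_fresh_mixedRefresh {Γ : Type*} [MeasurableSpace Γ] {A : Set ℝ}
    (hA : A.Countable) (t₀ r : ℝ) {x c : ℕ → Γ → ℝ} {t : Γ → ℝ} (hx : ∀ n, Measurable (x n))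
    (hc : ∀ n, Measurable (c n)) (ht : Measurable t) :
    MeasurableSet {g | fresh (Set.range fun n => x n g) (mixedRefresh A (fun n => c n g) t₀ r)
      (t g)} := by
  have hset : ∀ y : Γ → ℝ, Measurable y →
      MeasurableSet {g | y g < t g ∧ ∀ k, x k g < t g → x k g < y g} := by
    intro y hy
    have : {g | y g < t g ∧ ∀ k, x k g < t g → x k g < y g} =
        {g | y g < t g} ∩ ⋂ k, ({g | x k g < t g}ᶜ ∪ {g | x k g < y g}) := by
      ext g
      simp [imp_iff_not_or]
    rw [this]
    exact (measurableSet_lt hy ht).inter (.iInter fun k =>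
      (measurableSet_lt (hx k) ht).compl.union (measurableSet_lt (hx k) hy))
  have : {g | fresh (Set.range fun n => x n g) (mixedRefresh A (fun n => c n g) t₀ r) (t g)} =
      (⋃ y ∈ A, {g | y < t g ∧ ∀ k, x k g < t g → x k g < y}) ∪
        ⋃ n, {g | 0 < r} ∩
          {g | t₀ + c n g / r < t g ∧ ∀ k, x k g < t g → x k g < t₀ + c n g / r} := by
    ext g
    simp only [fresh, mixedRefresh, Set.mem_union, Set.mem_ofPred_eq, Set.forall_mem_range,
      Set.mem_iUnion, Set.mem_inter_iff, or_and_right, exists_or, exists_prop]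
    refine or_congr Iff.rfl ⟨?_, ?_⟩
    · rintro ⟨y, ⟨hr, n, rfl⟩, h⟩
      exact ⟨n, hr, h⟩
    · rintro ⟨n, hr, h⟩
      exact ⟨_, ⟨hr, n, rfl⟩, h⟩
  rw [this]
  refine (MeasurableSet.biUnion hA fun y _ => hset _ measurable_const).union
    (.iUnion fun n => (MeasurableSet.const _).inter (hset _ ?_))
  have := hc n
  fun_prop

theorem antitone_noEvent {Ω : Type*} (x : ℕ → Ω → ℝ) {f : ℝ → ℝ} (hf : Antitone f) (b : ℝ) :
    Antitone fun s => noEvent x (f s) b :=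
  fun _ _ hst _ hω n hn => hω n ⟨(hf hst).trans hn.1, hn.2⟩

theorem countable_uniformRefresh (m : ℕ) (R : ℝ) (N : ℕ) : (uniformRefresh m R N).Countable :=
  (Set.countable_range fun k : ℕ => (k : ℝ) * (m / R)).mono (by
    rintro y ⟨k, -, rfl⟩
    exact ⟨k, rfl⟩)

section Model

variable {Ω : Type*} [MeasurableSpace Ω] {m : ℕ} {P : CrawlProcesses Ω m} {ξ ζ : Fin m → ℝ}
  {μ : Measure Ω}

theorem IsCrawlModel.measurableSet_fresh (h : IsCrawlModel P ξ ζ μ) {A : Set ℝ} (hA : A.Countable)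
    (i : Fin m) (t₀ r : ℝ) {t : Ω → ℝ} (ht : Measurable t) :
    MeasurableSet {ω | fresh (P.changeTimes i ω) (mixedRefresh A (fun n => P.clock i n ω) t₀ r)
      (t ω)} :=
  measurableSet_fresh_mixedRefresh hA t₀ r (h.change i).measurable (h.clock i).measurable ht

variable [IsProbabilityMeasure μ]

/-- With an empty cache at the start, a page is fresh with at most the stationary probability. -/
theorem IsCrawlModel.measureReal_fresh_le (h : IsCrawlModel P ξ ζ μ) (hm : 0 < m)
    (hξ : ∀ i, 0 < ξ i) (i : Fin m) {r t : ℝ} (hr : 0 ≤ r) (ht : 0 ≤ t) :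
    μ.real {ω | fresh (P.changeTimes i ω) (mixedRefresh ∅ (fun n => P.clock i n ω) 0 r) t} ≤
      r / (r + ξ i) := by
  have hξi := hξ i
  -- In this race the clock comes first and the changes second: freshness requires a clock event in
  -- the past and no change after it. A span `s` of real time is a span `r s` of the rate-`1` clock.
  have key := measureReal_inter_le_of_race (μ := μ) (E := Set.univ)
    (B := {ω | fresh (P.changeTimes i ω) (mixedRefresh ∅ (fun n => P.clock i n ω) 0 r) t})
    (U := fun s => noEvent (P.clock i) (r * (t - s)) (r * t))
    (V := fun s => noEvent (P.change i) (t - s) t) hr hξi.le (by positivity) ht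
    (fun ω n => by simp) ?_ ?_ ?_ .univ (fun s => measurableSet_noEvent (h.clock i).measurable _ _)
    (fun s => measurableSet_noEvent (h.change i).measurable _ _) ?_
  · simpa using key
  · rintro ω ⟨y, hy, hyt, -⟩ hω
    obtain hy | ⟨hr, n, rfl⟩ := hy
    · exact hy
    · refine hω n ⟨by simpa using ((h.clock i).pos n ω).le, ?_⟩
      rw [zero_add, div_lt_iff₀ hr] at hyt
      linarith
  · rintro ω ⟨y, hy, hyt, hch⟩ s hs hω n ⟨hn1, hn2⟩
    have h1 := hch _ ⟨n, rfl⟩ hn2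
    obtain hy | ⟨hr, k, rfl⟩ := hy
    · exact hy
    · rw [zero_add] at hyt h1
      refine hω k ⟨?_, ?_⟩
      · rw [← le_div_iff₀' hr]
        exact hn1.trans h1.le
      · rwa [div_lt_iff₀' hr] at hyt
  · exact antitone_noEvent _ (fun s s' hss => by gcongr) _
  · intro s hs s' hs'
    -- With `N = 0` there is nothing to observe, so the observation event is the whole space.
    have h1 := h.measureReal_observation_inter hm zero_lt_one hξ (N := 0) i
      (observation P 1 0 (Classical.choice (by
        by_contra hne
        rw [not_nonempty_iff] at hne
        have := measure_univ (μ := μ)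
        simp [Set.univ_eq_empty_iff.2 hne] at this)))
      (a := t - s') (b := t) (c := r * (t - s)) (d := r * t) (by simpa using hs'.2)
      (by linarith [hs'.1]) (mul_nonneg hr (by linarith [hs.2]))
      (mul_le_mul_of_nonneg_left (by linarith [hs.1]) hr)
    have h2 : ∀ o : Fin m → Fin 0 → Prop, {ω | observation P 1 0 ω = o} = Set.univ := by
      intro o
      ext ω
      simp [observation_eq_iff]
    rw [h2, Set.univ_inter] at h1
    rw [Set.univ_inter, Set.inter_comm, h1, mul_assoc, mul_assoc, ← Real.exp_add, ← Real.exp_add]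
    ring_nf

/-- After the exploration phase, which ends with a refresh, a page is fresh with at least the
stationary probability, whatever was observed. -/
theorem IsCrawlModel.le_measureReal_fresh (h : IsCrawlModel P ξ ζ μ) (hm : 0 < m) {R : ℝ}
    (hR : 0 < R) (hξ : ∀ i, 0 < ξ i) (i : Fin m) {N : ℕ} (o : Fin m → Fin N → Prop) {r t : ℝ}
    (hr : 0 ≤ r) (ht : N * (m / R) < t) :
    μ.real {ω | observation P R N ω = o} * (r / (r + ξ i)) ≤
      μ.real ({ω | observation P R N ω = o} ∩ {ω | fresh (P.changeTimes i ω)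
        (mixedRefresh (uniformRefresh m R N) (fun n => P.clock i n ω) (N * (m / R)) r) t}) := by
  have hξi := hξ i
  set τ : ℝ := N * (m / R) with hτ
  set E := {ω | observation P R N ω = o} with hE
  set G := {ω | fresh (P.changeTimes i ω)
        (mixedRefresh (uniformRefresh m R N) (fun n => P.clock i n ω) τ r) t} with hG
  have hτmem : ∀ ω, τ ∈ mixedRefresh (uniformRefresh m R N) (fun n => P.clock i n ω) τ r :=
    fun ω => Or.inl ⟨N, le_rfl, hτ⟩
  have hEm : MeasurableSet E := h.measurable_observation hm hR N (.of_discrete (s := {o}))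
  have hGm : MeasurableSet G :=
    h.measurableSet_fresh (countable_uniformRefresh m R N) i τ r measurable_const
  -- The roles are exchanged and the race is stopped at `τ`: since `τ` is a refresh time, a page
  -- that is not fresh has changed since `τ` and has had no clock event after that change.
  have key := measureReal_inter_le_of_race (μ := μ) (E := E) (B := Gᶜ)
    (U := fun s => noEvent (P.change i) (t - s) t)
    (V := fun s => noEvent (P.clock i) (r * (t - τ - s)) (r * (t - τ))) (D := t - τ)
    hξi.le hr (by positivity) (by linarith) (fun ω n => by simp) ?_ ?_ ?_ hEm
    (fun s => measurableSet_noEvent (h.change i).measurable _ _)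
    (fun s => measurableSet_noEvent (h.clock i).measurable _ _) ?_
  · have h1 := measureReal_inter_add_sdiff (μ := μ) (s := E) hGm
    rw [← Set.sdiff_eq] at key
    have h2 : μ.real E * (r / (r + ξ i)) = μ.real E - μ.real E * (ξ i / (ξ i + r)) := by
      field_simp
      ring
    linarith
  · intro ω hω hU
    refine hω ⟨τ, hτmem ω, ht, ?_⟩
    rintro _ ⟨n, rfl⟩ hn
    by_contra! h'
    exact hU n ⟨by linarith, hn⟩
  · intro ω hω s hs hU k hk
    obtain hr0 | hr0 := hr.eq_or_lt
    · simp [← hr0] at hk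
    refine hω ⟨τ + P.clock i k ω / r, Or.inr ⟨hr0, k, rfl⟩, ?_, ?_⟩
    · have := (div_lt_iff₀' hr0).2 hk.2
      linarith
    · rintro _ ⟨n, rfl⟩ hn
      by_contra! h'
      have := (le_div_iff₀' hr0).2 hk.1
      exact hU n ⟨by linarith, hn⟩
  · exact antitone_noEvent _ (fun s s' hss => by gcongr) _
  · intro s hs s' hs'
    rw [h.measureReal_observation_inter hm hR hξ i o (by linarith [hs.2]) (by linarith [hs.1])
      (mul_nonneg hr (by linarith [hs'.2])) (mul_le_mul_of_nonneg_left (by linarith [hs'.1]) hr)]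
    congr 3 <;> ring

end Model

/-! ### Expected number of requests that find a fresh page -/

section Count

variable {Ω : Type*} [MeasurableSpace Ω] {x : ℕ → Ω → ℝ} {rate T : ℝ} {μ : Measure Ω}
  {Q : ℕ → Set Ω}

namespace IsPoissonProcess

theorem finite_mem (h : IsPoissonProcess x rate μ) (hT : ∀ n, ∀ ω ∈ Q n, x n ω ≤ T) (ω : Ω) :
    {n | ω ∈ Q n}.Finite :=
  (h.finite_le T ω).subset fun n hn => hT n ω hn

theorem setLIntegral_ncard (h : IsPoissonProcess x rate μ) (hQ : ∀ n, MeasurableSet (Q n))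
    (hT : ∀ n, ∀ ω ∈ Q n, x n ω ≤ T) (E : Set Ω) :
    ∫⁻ ω in E, ({n | ω ∈ Q n}.ncard : ℝ≥0∞) ∂μ = ∑' n, μ (E ∩ Q n) := by
  simp only [natCast_ncard_eq_tsum (h.finite_mem hT _)]
  rw [lintegral_tsum fun n => (measurable_one.indicator (hQ n)).aemeasurable]
  congr with n
  rw [lintegral_indicator_one (hQ n), Measure.restrict_apply (hQ n), Set.inter_comm]

theorem measurable_ncard (h : IsPoissonProcess x rate μ) (hQ : ∀ n, MeasurableSet (Q n))
    (hT : ∀ n, ∀ ω ∈ Q n, x n ω ≤ T) : Measurable fun ω => ({n | ω ∈ Q n}.ncard : ℝ≥0∞) := by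
  simp only [natCast_ncard_eq_tsum (h.finite_mem hT _)]
  exact Measurable.tsum fun n => measurable_one.indicator (hQ n)

theorem tsum_measure_inter_ne_top (h : IsPoissonProcess x rate μ)
    (hT : ∀ n, ∀ ω ∈ Q n, x n ω ≤ T) (E : Set Ω) : ∑' n, μ (E ∩ Q n) ≠ ∞ := by
  refine ne_top_of_le_ne_top ?_ (ENNReal.tsum_le_tsum fun n => measure_mono (t :=
    x n ⁻¹' Set.Ioc ((0 : ℝ≥0) : ℝ) (T.toNNReal : ℝ)) fun ω hω => ?_)
  · rw [h.tsum_measure_Ioc zero_le]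
    exact ENNReal.ofReal_ne_top
  · exact ⟨h.pos n ω, (hT n ω hω.2).trans (Real.le_coe_toNNReal T)⟩

theorem integrable_ncard (h : IsPoissonProcess x rate μ) (hQ : ∀ n, MeasurableSet (Q n))
    (hT : ∀ n, ∀ ω ∈ Q n, x n ω ≤ T) : Integrable (fun ω => ({n | ω ∈ Q n}.ncard : ℝ)) μ := by
  have h1 : ∫⁻ ω, ({n | ω ∈ Q n}.ncard : ℝ≥0∞) ∂μ ≠ ∞ := by
    rw [← setLIntegral_univ, h.setLIntegral_ncard hQ hT]
    exact h.tsum_measure_inter_ne_top hT _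
  simpa using integrable_toReal_of_lintegral_ne_top (h.measurable_ncard hQ hT).aemeasurable h1

theorem setIntegral_ncard (h : IsPoissonProcess x rate μ) (hQ : ∀ n, MeasurableSet (Q n))
    (hT : ∀ n, ∀ ω ∈ Q n, x n ω ≤ T) (E : Set Ω) :
    ∫ ω in E, ({n | ω ∈ Q n}.ncard : ℝ) ∂μ = (∑' n, μ (E ∩ Q n)).toReal := by
  rw [← h.setLIntegral_ncard hQ hT E, ← integral_toReal
    (h.measurable_ncard hQ hT).aemeasurable (ae_of_all _ fun ω => ENNReal.natCast_lt_top _)]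
  simp

/-- Campbell's formula for a Poisson process and an independent random element. -/
theorem tsum_measure_mem_eq [IsProbabilityMeasure μ] (h : IsPoissonProcess x rate μ)
    (hrate : 0 ≤ rate) {Γ : Type*} [MeasurableSpace Γ] {γ : Ω → Γ} (hγ : Measurable γ)
    (hind : IndepFun (fun ω n => x n ω) γ μ) {S : Set (ℝ × Γ)} (hS : MeasurableSet S) :
    ∑' n, μ {ω | (x n ω, γ ω) ∈ S} =
      ENNReal.ofReal rate * ∫⁻ t in Set.Ioi 0, μ {ω | (t, γ ω) ∈ S} := by
  -- Fubini for each single event time; the sum of their laws is the intensity measure.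
  have h1 : ∀ n, μ {ω | (x n ω, γ ω) ∈ S} = ∫⁻ t, μ {ω | (t, γ ω) ∈ S} ∂(μ.map (x n)) := by
    intro n
    have h2 : IndepFun (x n) γ μ := hind.comp (measurable_pi_apply n) measurable_id
    have h3 := (indepFun_iff_map_prod_eq_prod_map_map (h.measurable n).aemeasurable
      hγ.aemeasurable).1 h2
    have := Measure.isProbabilityMeasure_map (μ := μ) hγ.aemeasurable
    calc μ {ω | (x n ω, γ ω) ∈ S} = μ.map (fun ω => (x n ω, γ ω)) S :=
          (Measure.map_apply ((h.measurable n).prodMk hγ) hS).symm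
      _ = ∫⁻ t, μ.map γ (Prod.mk t ⁻¹' S) ∂(μ.map (x n)) := by rw [h3, Measure.prod_apply hS]
      _ = _ := by
          congr with t
          rw [Measure.map_apply hγ (measurable_prodMk_left hS)]
          rfl
  rw [tsum_congr h1, ← lintegral_sum_measure, h.sum_map_eq hrate, lintegral_smul_measure,
    smul_eq_mul]

end IsPoissonProcess

end Count

section Model

variable {Ω : Type*} {m : ℕ} {P : CrawlProcesses Ω m} {ξ ζ : Fin m → ℝ}

/-- The event that the `n`-th request of page `i` is in `[t₁, t₂]` and finds a fresh page, if the
page is refreshed at the times `A` and at rate `r` from time `t₀` on. -/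
def freshRequest (P : CrawlProcesses Ω m) (i : Fin m) (A : Set ℝ) (t₀ r t₁ t₂ : ℝ) (n : ℕ) :
    Set Ω :=
  {ω | P.request i n ω ∈ Set.Icc t₁ t₂ ∧ fresh (P.changeTimes i ω)
    (mixedRefresh A (fun n => P.clock i n ω) t₀ r) (P.request i n ω)}

theorem freshRequest_le (i : Fin m) (A : Set ℝ) (t₀ r t₁ t₂ : ℝ) (n : ℕ) :
    ∀ ω ∈ freshRequest P i A t₀ r t₁ t₂ n, P.request i n ω ≤ t₂ :=
  fun _ hω => hω.1.2

variable [MeasurableSpace Ω] {μ : Measure Ω}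

namespace IsCrawlModel

theorem measurableSet_freshRequest (h : IsCrawlModel P ξ ζ μ) (i : Fin m) {A : Set ℝ}
    (hA : A.Countable) (t₀ r t₁ t₂ : ℝ) (n : ℕ) :
    MeasurableSet (freshRequest P i A t₀ r t₁ t₂ n) :=
  ((h.request i).measurable n measurableSet_Icc).inter
    (h.measurableSet_fresh hA i t₀ r ((h.request i).measurable n))

/-- The requests of a page are independent of all changes and of the clock of this page. -/
theorem indepFun_request (h : IsCrawlModel P ξ ζ μ) (i : Fin m) :
    IndepFun (fun ω n => P.request i n ω)
      (fun ω => ((fun j n => P.change j n ω, fun n => P.clock i n ω) :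
        (Fin m → ℕ → ℝ) × (ℕ → ℝ))) μ := by
  classical
  have hmeas : ∀ k, Measurable ((Sum.elim (fun i ω n => P.change i n ω)
    (Sum.elim (fun i ω n => P.request i n ω) (fun i ω n => P.clock i n ω)) :
      Fin m ⊕ (Fin m ⊕ Fin m) → Ω → ℕ → ℝ) k) := by
    rintro (j | j | j)
    exacts [h.measurable_change j, h.measurable_request j, h.measurable_clock j]
  have h1 := h.indep.indepFun_finset {Sum.inr (Sum.inl i)}
    (Finset.univ.erase (Sum.inr (Sum.inl i))) (by simp) hmeas
  have hψ : Measurable fun f : (Finset.univ.erase (Sum.inr (Sum.inl i)) :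
      Finset (Fin m ⊕ (Fin m ⊕ Fin m))) → ℕ → ℝ =>
      ((fun j => f ⟨Sum.inl j, by simp⟩, f ⟨Sum.inr (Sum.inr i), by simp⟩) :
        (Fin m → ℕ → ℝ) × (ℕ → ℝ)) :=
    Measurable.prodMk (measurable_pi_lambda _ fun j => measurable_pi_apply _)
      (measurable_pi_apply _)
  have hφ : Measurable fun f : ({Sum.inr (Sum.inl i)} : Finset (Fin m ⊕ (Fin m ⊕ Fin m))) → ℕ → ℝ =>
      f ⟨Sum.inr (Sum.inl i), by simp⟩ := measurable_pi_apply _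
  exact h1.comp hφ hψ

/-- Campbell's formula for the requests that find a fresh page. -/
theorem tsum_measure_freshRequest [IsProbabilityMeasure μ] (h : IsCrawlModel P ξ ζ μ) (hm : 0 < m)
    (hζ : ∀ i, 0 < ζ i) {R : ℝ} (hR : 0 < R) {N : ℕ} (O : Set (Fin m → Fin N → Prop)) (i : Fin m)
    {A : Set ℝ} (hA : A.Countable) (t₀ r t₁ t₂ : ℝ) :
    ∑' n, μ ({ω | observation P R N ω ∈ O} ∩ freshRequest P i A t₀ r t₁ t₂ n) =
      ENNReal.ofReal (ζ i) * ∫⁻ t in Set.Ioi 0, (Set.Icc t₁ t₂).indicator (fun t =>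
        μ ({ω | observation P R N ω ∈ O} ∩
          {ω | fresh (P.changeTimes i ω) (mixedRefresh A (fun n => P.clock i n ω) t₀ r) t})) t := by
  let Γ := (Fin m → ℕ → ℝ) × (ℕ → ℝ)
  let γ : Ω → Γ := fun ω => (fun j n => P.change j n ω, fun n => P.clock i n ω)
  -- The model on path space, so that observations and freshness become functions of `γ`. Requests
  -- play no role in either and are set to zero.
  let P' : CrawlProcesses Γ m := ⟨fun j n g => g.1 j n, fun _ _ _ => 0, fun _ n g => g.2 n⟩
  have hγ : Measurable γ :=
    (measurable_pi_lambda _ h.measurable_change).prodMk (h.measurable_clock i)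
  have hchange : ∀ j n, Measurable (P'.change j n) := fun j n =>
    (measurable_pi_apply n).comp ((measurable_pi_apply j).comp measurable_fst)
  have hclock : ∀ j n, Measurable (P'.clock j n) := fun j n =>
    (measurable_pi_apply n).comp measurable_snd
  have hobs : Measurable (observation P' R N) :=
    measurable_pi_lambda _ fun j => measurable_pi_lambda _ fun n => measurableSet_setOfPred.1 (by
      simp only [observation_iff_mem_noEvent hm hR]
      exact measurableSet_noEvent (hchange j) _ _)
  let S : Set (ℝ × Γ) := {p | p.1 ∈ Set.Icc t₁ t₂ ∧ observation P' R N p.2 ∈ O ∧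
    fresh (P'.changeTimes i p.2) (mixedRefresh A (fun n => P'.clock i n p.2) t₀ r) p.1}
  have hS : MeasurableSet S :=
    (measurable_fst measurableSet_Icc).inter (((hobs.comp measurable_snd) (.of_discrete (s := O))).inter
      (measurableSet_fresh_mixedRefresh hA t₀ r (fun n => (hchange i n).comp measurable_snd)
        (fun n => (hclock i n).comp measurable_snd) measurable_fst))
  have h1 := (h.request i).tsum_measure_mem_eq (hζ i).le hγ (h.indepFun_request i) hS
  calc _ = ∑' n, μ {ω | (P.request i n ω, γ ω) ∈ S} := by
        congr with n
        congr 1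
        ext ω
        exact and_left_comm
    _ = _ := by
        rw [h1]
        congr with t
        by_cases ht : t ∈ Set.Icc t₁ t₂
        · rw [Set.indicator_of_mem ht]
          congr 1
          ext ω
          exact and_iff_right ht
        · rw [Set.indicator_of_notMem ht]
          convert measure_empty (μ := μ)
          ext ω
          simp only [Set.mem_ofPred_eq, Set.mem_empty_iff_false, iff_false]
          exact fun hω => ht hω.1

end IsCrawlModel

end Model

/-! ### Expected utilities -/

/-- A lower bound for a conditional expectation given a finite-valued random variable. -/
theorem ae_le_condExp_comap_of_finite {Ω β : Type*} [mΩ : MeasurableSpace Ω] {μ : Measure Ω}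
    [IsProbabilityMeasure μ] [mβ : MeasurableSpace β] [Finite β] [MeasurableSingletonClass β]
    {Y : Ω → β} (hY : Measurable Y) {f : Ω → ℝ} (hf : Integrable f μ) {g : β → ℝ}
    (hg : ∀ b, μ.real (Y ⁻¹' {b}) * g b ≤ ∫ ω in Y ⁻¹' {b}, f ω ∂μ) :
    ∀ᵐ ω ∂μ, g (Y ω) ≤ (μ[f | MeasurableSpace.comap Y mβ]) ω := by
  have hle : MeasurableSpace.comap Y mβ ≤ mΩ := hY.comap_le
  -- The conditional expectation is constant on each level set of `Y`, so integrating over a level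
  -- set of positive measure compares it with `g`; the null level sets are finitely many.
  obtain ⟨φ, -, hφ⟩ := (stronglyMeasurable_condExp (μ := μ) (f := f)
    (m := MeasurableSpace.comap Y mβ)).exists_eq_measurable_comp
  have hnull : ∀ᵐ ω ∂μ, ∀ b, μ (Y ⁻¹' {b}) = 0 → Y ω ≠ b := by
    rw [ae_all_iff]
    intro b
    by_cases hb : μ (Y ⁻¹' {b}) = 0
    · have : ∀ᵐ ω ∂μ, ω ∉ Y ⁻¹' {b} := measure_eq_zero_iff_ae_notMem.1 hb
      filter_upwards [this] with ω hω _ using hω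
    · exact ae_of_all _ fun ω h => absurd h hb
  filter_upwards [hnull] with ω hω
  have hpos : 0 < μ.real (Y ⁻¹' {Y ω}) := by
    rw [measureReal_def]
    exact ENNReal.toReal_pos (fun h => hω _ h rfl) (measure_ne_top _ _)
  have h1 := setIntegral_condExp hle hf (s := Y ⁻¹' {Y ω}) ⟨{Y ω}, measurableSet_singleton _, rfl⟩
  have h2 : ∫ ω' in Y ⁻¹' {Y ω}, (μ[f | MeasurableSpace.comap Y mβ]) ω' ∂μ =
      μ.real (Y ⁻¹' {Y ω}) * φ (Y ω) := by
    rw [setIntegral_congr_fun (g := fun _ => φ (Y ω)) (hY (measurableSet_singleton _)),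
      setIntegral_const, smul_eq_mul]
    intro ω' hω'
    rw [hφ, Function.comp_apply, show Y ω' = Y ω from hω']
  have h3 := hg (Y ω)
  rw [← h1, h2] at h3
  rw [hφ]
  exact le_of_mul_le_mul_left h3 hpos

section Model

variable {Ω : Type*} {m : ℕ} {P : CrawlProcesses Ω m} {ξ ζ : Fin m → ℝ}

/-- The utility in `[0, T]` of refreshing all pages at the times in `A`, and in addition page `i` at
rate `ρ i` from time `t₀` on. -/
noncomputable def mixedUtility (P : CrawlProcesses Ω m) (A : Set ℝ) (t₀ : ℝ) (ρ : Fin m → ℝ) (T : ℝ)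
    (ω : Ω) : ℝ :=
  1 / (m : ℝ) * ∑ i, ({n | ω ∈ freshRequest P i A t₀ (ρ i) 0 T n}.ncard : ℝ)

/-- On each observation event the committed rates are thus deterministic, and the bounds for fixed
rates apply. -/
theorem commitRate_congr {R ξmin ξmax : ℝ} {N : ℕ} {ω ω' : Ω}
    (hω : observation P R N ω = observation P R N ω') :
    commitRate P R ξmin ξmax ζ N ω = commitRate P R ξmin ξmax ζ N ω' := by
  unfold commitRate estimate noChangeFraction
  rw [hω]

theorem isOptimalRate_commitRate (hm : 0 < m) {R ξmin : ℝ} (hR : 0 < R) (hξmin : 0 < ξmin)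
    (ξmax : ℝ) (N : ℕ) (ω : Ω) :
    IsOptimalRate R ζ (estimate P R ξmin ξmax N ω) (commitRate P R ξmin ξmax ζ N ω) :=
  isOptimalRate_optimalRate hm hR.le _ _ fun _ => hξmin.trans_le (le_max_left _ _)

variable [MeasurableSpace Ω] {μ : Measure Ω}

namespace IsCrawlModel

theorem integrable_mixedUtility (h : IsCrawlModel P ξ ζ μ) {A : Set ℝ} (hA : A.Countable) (t₀ : ℝ)
    (ρ : Fin m → ℝ) (T : ℝ) : Integrable (mixedUtility P A t₀ ρ T) μ := by
  refine Integrable.const_mul (integrable_finsetSum _ fun i _ => ?_) _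
  exact (h.request i).integrable_ncard (h.measurableSet_freshRequest i hA _ _ _ _)
    (freshRequest_le i A _ _ _ _)

theorem setIntegral_mixedUtility (h : IsCrawlModel P ξ ζ μ) {A : Set ℝ} (hA : A.Countable) (t₀ : ℝ)
    (ρ : Fin m → ℝ) (T : ℝ) (E : Set Ω) :
    ∫ ω in E, mixedUtility P A t₀ ρ T ω ∂μ =
      1 / (m : ℝ) * ∑ i, (∑' n, μ (E ∩ freshRequest P i A t₀ (ρ i) 0 T n)).toReal := by
  unfold mixedUtility
  rw [integral_const_mul, integral_finsetSum]
  · congr 1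
    refine Finset.sum_congr rfl fun i _ => ?_
    exact (h.request i).setIntegral_ncard (h.measurableSet_freshRequest i hA _ _ _ _)
      (freshRequest_le i A _ _ _ _) E
  · exact fun i _ => ((h.request i).integrable_ncard (h.measurableSet_freshRequest i hA _ _ _ _)
      (freshRequest_le i A _ _ _ _)).integrableOn

theorem utility_rateSchedule (h : IsCrawlModel P ξ ζ μ) {ρ : Fin m → ℝ} (hρ : ∀ i, 0 ≤ ρ i) (T : ℝ)
    (ω : Ω) : utility P (rateSchedule P ρ ω) 0 T ω = mixedUtility P ∅ 0 ρ T ω := by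
  have : rateSchedule P ρ ω = fun i => mixedRefresh ∅ (fun n => P.clock i n ω) 0 (ρ i) := by
    ext1 i
    rw [← union_poissonRefresh_eq ∅ (fun n => (h.clock i).pos n ω) 0 (hρ i), Set.empty_union]
    rfl
  rw [this]
  rfl

theorem utility_etcSchedule (h : IsCrawlModel P ξ ζ μ) {R ξmin ξmax : ℝ} {N : ℕ} {ω : Ω}
    (hρ : ∀ i, 0 ≤ commitRate P R ξmin ξmax ζ N ω i) (T : ℝ) :
    utility P (etcSchedule P R ξmin ξmax ζ N ω) 0 T ω =
      mixedUtility P (uniformRefresh m R N) (N * (m / R)) (commitRate P R ξmin ξmax ζ N ω) T ω := by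
  have : etcSchedule P R ξmin ξmax ζ N ω = fun i => mixedRefresh (uniformRefresh m R N)
      (fun n => P.clock i n ω) (N * (m / R)) (commitRate P R ξmin ξmax ζ N ω i) := by
    ext1 i
    rw [← union_poissonRefresh_eq _ (fun n => (h.clock i).pos n ω) _ (hρ i)]
    rfl
  rw [this]
  rfl

variable [IsProbabilityMeasure μ]

/-- A Poisson policy that starts with an empty cache earns at most its stationary utility. -/
theorem integral_utility_rateSchedule_le (h : IsCrawlModel P ξ ζ μ) (hm : 0 < m)
    (hξ : ∀ i, 0 < ξ i) (hζ : ∀ i, 0 < ζ i) {R : ℝ} {ρ : Fin m → ℝ} (hρ : ρ ∈ ratePolicies m R)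
    {T : ℝ} (hT : 0 ≤ T) :
    ∫ ω, utility P (rateSchedule P ρ ω) 0 T ω ∂μ ≤ T / m * statUtility ζ ρ ξ := by
  simp only [h.utility_rateSchedule hρ.1]
  rw [← setIntegral_univ, h.setIntegral_mixedUtility Set.countable_empty]
  have key : ∀ i, (∑' n, μ (Set.univ ∩ freshRequest P i ∅ 0 (ρ i) 0 T n)).toReal ≤
      T * (ρ i * ζ i / (ρ i + ξ i)) := by
    intro i
    have hρi := hρ.1 i
    have hξi := hξ i
    have hζi := hζ i
    have h1 := h.tsum_measure_freshRequest hm hζ zero_lt_one (N := 0) Set.univ i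
      Set.countable_empty 0 (ρ i) 0 T
    simp only [Set.mem_univ, Set.ofPred_true] at h1
    rw [h1]
    refine ENNReal.toReal_le_of_le_ofReal (by positivity) ?_
    calc _ ≤ ENNReal.ofReal (ζ i) * ∫⁻ t in Set.Ioi 0, (Set.Icc 0 T).indicator (fun _ =>
          ENNReal.ofReal (ρ i / (ρ i + ξ i))) t := by
          refine mul_le_mul' le_rfl (lintegral_mono fun t => Set.indicator_le_indicator' fun ht => ?_)
          rw [Set.univ_inter, ← ofReal_measureReal]
          exact ENNReal.ofReal_le_ofReal (h.measureReal_fresh_le hm hξ i hρi ht.1)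
      _ ≤ ENNReal.ofReal (ζ i) * (ENNReal.ofReal (ρ i / (ρ i + ξ i)) * ENNReal.ofReal T) := by
          rw [lintegral_indicator_const measurableSet_Icc]
          gcongr
          refine (Measure.restrict_apply_le _ _).trans ?_
          simp
      _ = _ := by
          rw [← ENNReal.ofReal_mul (by positivity), ← ENNReal.ofReal_mul (by positivity)]
          congr 1
          ring
  calc _ ≤ 1 / (m : ℝ) * ∑ i, T * (ρ i * ζ i / (ρ i + ξ i)) := by
        gcongr with i
        exact key i
    _ = _ := by rw [← Finset.mul_sum, statUtility]; ring

/-- After the exploration phase, a Poisson policy earns at least its stationary utility, whatever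
was observed. -/
theorem le_setIntegral_mixedUtility (h : IsCrawlModel P ξ ζ μ) (hm : 0 < m)
    (hξ : ∀ i, 0 < ξ i) (hζ : ∀ i, 0 < ζ i) {R : ℝ} (hR : 0 < R) {N : ℕ}
    (o : Fin m → Fin N → Prop) {ρ : Fin m → ℝ} (hρ : ∀ i, 0 ≤ ρ i) {T : ℝ}
    (hT : N * (m / R) ≤ T) :
    μ.real {ω | observation P R N ω = o} * ((T - N * (m / R)) / m * statUtility ζ ρ ξ) ≤
      ∫ ω in {ω | observation P R N ω = o},
        mixedUtility P (uniformRefresh m R N) (N * (m / R)) ρ T ω ∂μ := by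
  have hA := countable_uniformRefresh m R N
  have hτ0 : 0 ≤ N * ((m : ℝ) / R) := by positivity
  rw [h.setIntegral_mixedUtility hA]
  set E := {ω | observation P R N ω = o} with hE
  set τ : ℝ := N * (m / R) with hτ
  have key : ∀ i, μ.real E * ((T - τ) * (ρ i * ζ i / (ρ i + ξ i))) ≤
      (∑' n, μ (E ∩ freshRequest P i (uniformRefresh m R N) τ (ρ i) 0 T n)).toReal := by
    intro i
    have hρi := hρ i
    have hξi := hξ i
    have hζi := hζ i
    have hTτ := sub_nonneg.2 hT
    rw [← ENNReal.ofReal_le_iff_le_toReal ((h.request i).tsum_measure_inter_ne_top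
      (freshRequest_le i _ _ _ _ _) E)]
    have h1 := h.tsum_measure_freshRequest hm hζ hR {o} i hA τ (ρ i) 0 T
    simp only [Set.mem_singleton_iff] at h1
    rw [h1]
    calc _ = ENNReal.ofReal (ζ i) * ∫⁻ t in Set.Ioc τ T,
          ENNReal.ofReal (μ.real E * (ρ i / (ρ i + ξ i))) := by
          rw [setLIntegral_const, Real.volume_Ioc, ← ENNReal.ofReal_mul (by positivity),
            ← ENNReal.ofReal_mul (by positivity)]
          congr 1
          ring
      _ ≤ _ := by
          refine mul_le_mul' le_rfl ?_
          rw [← lintegral_indicator measurableSet_Ioc, ← lintegral_indicator measurableSet_Ioi]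
          refine lintegral_mono fun t => ?_
          -- Requests during the exploration phase are dropped from the lower bound.
          by_cases ht : t ∈ Set.Ioc τ T
          · have ht0 : 0 < t := hτ0.trans_lt ht.1
            rw [Set.indicator_of_mem ht, Set.indicator_of_mem (Set.mem_Ioi.2 ht0),
              Set.indicator_of_mem (Set.mem_Icc.2 ⟨ht0.le, ht.2⟩), ← ofReal_measureReal]
            exact ENNReal.ofReal_le_ofReal (h.le_measureReal_fresh hm hR hξ i o hρi ht.1)
          · rw [Set.indicator_of_notMem ht]
            exact zero_le
  calc _ = 1 / (m : ℝ) * ∑ i, μ.real E * ((T - τ) * (ρ i * ζ i / (ρ i + ξ i))) := by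
        rw [← Finset.mul_sum, ← Finset.mul_sum, statUtility]; ring
    _ ≤ _ := by
        gcongr with i
        exact key i

end IsCrawlModel

/-- Given the exploration phase, explore-and-commit earns at least the stationary utility of the
rates it commits to. -/
theorem IsCrawlModel.ae_le_condExp_etcSchedule [IsProbabilityMeasure μ] (h : IsCrawlModel P ξ ζ μ)
    (hm : 0 < m) (hξ : ∀ i, 0 < ξ i) (hζ : ∀ i, 0 < ζ i) {R ξmin ξmax : ℝ} (hR : 0 < R)
    (hξmin : 0 < ξmin) {N : ℕ} {T : ℝ} (hT : N * (m / R) ≤ T) :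
    ∀ᵐ ω ∂μ, (T - N * (m / R)) / m * statUtility ζ (commitRate P R ξmin ξmax ζ N ω) ξ ≤
      (μ[fun ω' => utility P (etcSchedule P R ξmin ξmax ζ N ω') 0 T ω' |
        explorationInfo P R N]) ω := by
  classical
  obtain ⟨ρ, hρ⟩ := (Function.factorsThrough_iff (f := observation P R N)
    (commitRate P R ξmin ξmax ζ N)).1 fun _ _ => commitRate_congr
  have hρω : ∀ ω, commitRate P R ξmin ξmax ζ N ω = ρ (observation P R N ω) := fun ω =>
    congrFun hρ ω
  have hobs := h.measurable_observation hm hR N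
  have hutil : ∀ ω, utility P (etcSchedule P R ξmin ξmax ζ N ω) 0 T ω =
      mixedUtility P (uniformRefresh m R N) (N * (m / R)) (ρ (observation P R N ω)) T ω := by
    intro ω
    rw [h.utility_etcSchedule (isOptimalRate_commitRate hm hR hξmin ξmax N ω).1.1, hρω]
  have hutil_int : Integrable (fun ω => utility P (etcSchedule P R ξmin ξmax ζ N ω) 0 T ω) μ := by
    have h1 : Integrable (fun ω => ∑ o : Fin m → Fin N → Prop, (observation P R N ⁻¹' {o}).indicator
        (mixedUtility P (uniformRefresh m R N) (N * (m / R)) (ρ o) T) ω) μ :=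
      integrable_finsetSum _ fun o _ =>
        (h.integrable_mixedUtility (countable_uniformRefresh m R N) _ _ _).indicator
          (hobs (measurableSet_singleton o))
    refine h1.congr (ae_of_all _ fun ω => ?_)
    simp only [hutil]
    rw [Finset.sum_eq_single (observation P R N ω)]
    · rw [Set.indicator_of_mem (show ω ∈ observation P R N ⁻¹' {observation P R N ω} from rfl)]
    · intro o _ ho
      rw [Set.indicator_of_notMem]
      exact fun h' => ho h'.symm
    · simp
  have key := ae_le_condExp_comap_of_finite hobs hutil_int
    (g := fun o => (T - N * (m / R)) / m * statUtility ζ (ρ o) ξ) (fun o => ?_)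
  · filter_upwards [key] with ω hω
    rw [hρω]
    exact hω
  -- The value of `ρ` at an unrealized observation is arbitrary and need not be nonnegative, but the
  -- corresponding event is empty.
  · by_cases ho : ∃ ω, observation P R N ω = o
    · obtain ⟨ω₀, rfl⟩ := ho
      have hpos : ∀ i, 0 ≤ ρ (observation P R N ω₀) i := by
        rw [← hρω]
        exact (isOptimalRate_commitRate hm hR hξmin ξmax N ω₀).1.1
      refine (h.le_setIntegral_mixedUtility hm hξ hζ hR (observation P R N ω₀) hpos hT).trans_eq ?_
      refine setIntegral_congr_fun (hobs (measurableSet_singleton _)) fun ω hω => ?_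
      simp only [hutil]
      rw [show observation P R N ω = observation P R N ω₀ from hω]
    · have : observation P R N ⁻¹' {o} = ∅ := by
        ext ω
        simpa using fun h' => ho ⟨ω, h'⟩
      simp [this]

end Model

/-! ### Concentration of the no-change fraction -/

/-- Two-sided Hoeffding bound for independent events of equal probability. -/
theorem measureReal_sq_sum_sub_gt_le {Ω : Type*} [MeasurableSpace Ω] {μ : Measure Ω}
    [IsProbabilityMeasure μ] {N : ℕ} (hN : 0 < N) {p L : ℝ} (hL : 0 ≤ L) {q : Fin N → Ω → Prop}
    [∀ n ω, Decidable (q n ω)] (hq : ∀ n, MeasurableSet {ω | q n ω}) (hind : iIndepFun q μ)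
    (hp : ∀ n, μ.real {ω | q n ω} = p) :
    μ.real {ω | N * L / 2 < (∑ n, ((if q n ω then 1 else 0) - p)) ^ 2} ≤ 2 * Real.exp (-L) := by
  classical
  let g : Prop → ℝ := fun a => (if a then 1 else 0) - p
  have hg : Measurable g := .of_discrete
  have hX : ∀ n ω, (if q n ω then (1 : ℝ) else 0) - p = g (q n ω) := fun n ω => by simp [g]
  simp only [hX]
  have hind1 : iIndepFun (fun n ω => g (q n ω)) μ := hind.comp (fun _ => g) fun _ => hg
  have hind2 : iIndepFun (fun n ω => -g (q n ω)) μ := hind.comp (fun _ a => -g a) fun _ => hg.neg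
  have hsub : ∀ n, HasSubgaussianMGF (fun ω => g (q n ω)) (1 / 4) μ := by
    intro n
    have h1 := hasSubgaussianMGF_of_mem_Icc (μ := μ) (a := 0) (b := 1)
      (X := {ω | q n ω}.indicator 1) (measurable_one.indicator (hq n)).aemeasurable
      (ae_of_all _ fun ω => by by_cases h : q n ω <;> simp [h])
    rw [integral_indicator_one (hq n), hp n] at h1
    have hc : (‖(1 : ℝ) - 0‖₊ / 2) ^ 2 = 1 / 4 := by
      simp
      norm_num
    rw [hc] at h1
    convert h1 using 2 with ω
    by_cases h : q n ω <;> simp [g, h]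
  have hN' : (0 : ℝ) < N := by exact_mod_cast hN
  have hε : 0 ≤ √(N * L / 2) := Real.sqrt_nonneg _
  -- An indicator has variance proxy `1 / 4`, hence the sum has `N / 4`, and the threshold is chosen
  -- to make the exponent `-L`.
  have hval : -√(N * L / 2) ^ 2 / (2 * ((∑ _n : Fin N, (1 / 4 : ℝ≥0) : ℝ≥0) : ℝ)) = -L := by
    rw [Real.sq_sqrt (by positivity)]
    simp
    field_simp
    norm_num
  have h1 := HasSubgaussianMGF.measure_sum_ge_le_of_iIndepFun hind1 (s := Finset.univ)
    (c := fun _ => 1 / 4) (fun n _ => hsub n) hε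
  have h2 := HasSubgaussianMGF.measure_sum_ge_le_of_iIndepFun hind2 (s := Finset.univ)
    (c := fun _ => 1 / 4) (fun n _ => (hsub n).neg) hε
  rw [hval] at h1 h2
  calc _ ≤ μ.real ({ω | √(N * L / 2) ≤ ∑ n, g (q n ω)} ∪
        {ω | √(N * L / 2) ≤ ∑ n, -g (q n ω)}) := by
        refine measureReal_mono (fun ω hω => ?_) (measure_ne_top _ _)
        have h3 : √(N * L / 2) ≤ |∑ n, g (q n ω)| := Real.sqrt_le_iff.2
          ⟨abs_nonneg _, by rw [sq_abs]; exact (show _ < _ from hω).le⟩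
        rw [le_abs] at h3
        refine h3.imp id fun h3 => ?_
        simpa [Finset.sum_neg_distrib] using h3
    _ ≤ _ := (measureReal_union_le _ _).trans (by linarith)

section Model

variable {Ω : Type*} {m : ℕ} {P : CrawlProcesses Ω m} {ξ ζ : Fin m → ℝ}

theorem noChangeFraction_mem_Icc (R : ℝ) (N : ℕ) (i : Fin m) (ω : Ω) :
    noChangeFraction P R N i ω ∈ Set.Icc (0 : ℝ) 1 := by
  unfold noChangeFraction
  have h1 : ({n | observation P R N ω i n}.ncard : ℝ) ≤ N := by
    have := Set.ncard_le_card {n | observation P R N ω i n}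
    rw [Nat.card_eq_fintype_card, Fintype.card_fin] at this
    exact_mod_cast this
  refine ⟨by positivity, ?_⟩
  rw [one_div, inv_mul_eq_div]
  exact div_le_one_of_le₀ h1 (by positivity)

variable [MeasurableSpace Ω] {μ : Measure Ω} [IsProbabilityMeasure μ]

theorem IsCrawlModel.measureReal_noChangeFraction_gt_le (h : IsCrawlModel P ξ ζ μ) (hm : 0 < m)
    (hξ : ∀ i, 0 < ξ i) {R : ℝ} (hR : 0 < R) {N : ℕ} (hN : 0 < N) {L : ℝ} (hL : 0 ≤ L) (i : Fin m) :
    μ.real {ω | L / (2 * N) < (noChangeFraction P R N i ω - Real.exp (-(ξ i * (m / R)))) ^ 2} ≤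
      2 * Real.exp (-L) := by
  classical
  have hw : 0 < (m : ℝ) / R := by positivity
  have hN' : (0 : ℝ) < N := by exact_mod_cast hN
  have hp : ∀ n : Fin N, μ.real {ω | observation P R N ω i n} = Real.exp (-(ξ i * (m / R))) := by
    intro n
    simp only [observation_iff_mem_noEvent hm hR]
    refine ((h.change i).measureReal_noEvent (hξ i).le (by positivity) (by nlinarith)).trans ?_
    ring_nf
  have key := measureReal_sq_sum_sub_gt_le hN hL (fun n => h.measurableSet_observation hm hR i n)
    (h.iIndepFun_observation hm hR hξ i) hp
  refine le_trans (le_of_eq ?_) key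
  congr with ω
  have hcount : ({n | observation P R N ω i n}.ncard : ℝ) =
      ∑ n : Fin N, if observation P R N ω i n then 1 else 0 := by
    rw [Set.ncard_eq_toFinset_card']
    simp
  have hsum : (∑ n : Fin N, ((if observation P R N ω i n then 1 else 0) -
      Real.exp (-(ξ i * (m / R))))) =
        N * (noChangeFraction P R N i ω - Real.exp (-(ξ i * (m / R)))) := by
    rw [Finset.sum_sub_distrib, ← hcount, noChangeFraction]
    simp
    field_simp
  rw [hsum, mul_pow, div_lt_iff₀ (by positivity), div_lt_iff₀ (by norm_num)]
  constructor <;> intro h' <;> nlinarith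

/-- With probability at least `1 - δ`, all no-change fractions are close to their means. -/
theorem IsCrawlModel.le_measure_noChangeFraction (h : IsCrawlModel P ξ ζ μ) (hm : 0 < m)
    (hξ : ∀ i, 0 < ξ i) {R : ℝ} (hR : 0 < R) {N : ℕ} (hN : 0 < N) {δ : ℝ}
    (hδ : δ ∈ Set.Ioo (0 : ℝ) 1) :
    ENNReal.ofReal (1 - δ) ≤ μ {ω | ∀ i,
      (noChangeFraction P R N i ω - Real.exp (-(ξ i * (m / R)))) ^ 2 ≤
        Real.log (2 * m / δ) / (2 * N)} := by
  have hm1 : (1 : ℝ) ≤ m := by exact_mod_cast hm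
  have hL : 0 ≤ Real.log (2 * m / δ) := by
    refine Real.log_nonneg ?_
    rw [le_div_iff₀ hδ.1]
    linarith [hδ.2]
  set G := {ω | ∀ i, (noChangeFraction P R N i ω - Real.exp (-(ξ i * (m / R)))) ^ 2 ≤
        Real.log (2 * m / δ) / (2 * N)} with hG
  -- The union bound with `L = log (2 m / δ)` gives `m * 2 exp (-L) = δ`.
  have h1 : μ.real Gᶜ ≤ δ := by
    have hsub : Gᶜ ⊆ ⋃ i ∈ Finset.univ, {ω | Real.log (2 * m / δ) / (2 * N) <
        (noChangeFraction P R N i ω - Real.exp (-(ξ i * (m / R)))) ^ 2} := by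
      intro ω hω
      simpa [hG] using hω
    have hδ0 := hδ.1
    calc μ.real Gᶜ ≤ _ := measureReal_mono hsub (measure_ne_top _ _)
      _ ≤ ∑ i : Fin m, μ.real {ω | Real.log (2 * m / δ) / (2 * N) <
          (noChangeFraction P R N i ω - Real.exp (-(ξ i * (m / R)))) ^ 2} :=
          measureReal_biUnion_finset_le _ _
      _ ≤ ∑ i : Fin m, 2 * Real.exp (-Real.log (2 * m / δ)) :=
          Finset.sum_le_sum fun i _ => h.measureReal_noChangeFraction_gt_le hm hξ hR hN hL i
      _ = δ := by
          rw [Real.exp_neg, Real.exp_log (by positivity)]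
          simp
          field_simp
  have h2 : 1 ≤ μ.real G + μ.real Gᶜ := by
    rw [← probReal_univ (μ := μ), ← Set.union_compl_self G]
    exact measureReal_union_le _ _
  exact ENNReal.ofReal_le_of_le_toReal (by rw [← measureReal_def]; linarith)

end Model

/-! ### Regret of explore-and-commit -/

section Model

variable {Ω : Type*} {m : ℕ} {P : CrawlProcesses Ω m} {ξ ζ : Fin m → ℝ} {R ξmin ξmax T : ℝ} {N : ℕ}

/-- If the no-change fractions are accurate, then the stationary utility lost by explore-and-commit
after the exploration phase, plus all that could be earned in it, is small. -/
theorem stationary_gap_le (hm : 0 < m) (hR : 0 < R) (hξmin : 0 < ξmin) (hζ : ∀ i, 0 < ζ i)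
    (hξ : ∀ i, ξ i ∈ Set.Icc ξmin ξmax) (hN : 0 < N) (hT : N * (m / R) ≤ T) {L : ℝ} {ω : Ω}
    (hω : ∀ i, (noChangeFraction P R N i ω - Real.exp (-(ξ i * (m / R)))) ^ 2 ≤ L / (2 * N))
    {ρ : Fin m → ℝ} (hρ : ρ ∈ ratePolicies m R) :
    T / m * statUtility ζ ρ ξ -
        (T - N * (m / R)) / m * statUtility ζ (commitRate P R ξmin ξmax ζ N ω) ξ ≤
      (N * (m / R) / m + (T - N * (m / R)) / (N * (m / R)) *
        (Real.exp (2 * (ξmax * m / R)) * R * L / (2 * m ^ 2 * ξmin ^ 2))) * ∑ i, ζ i := by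
  have hm' : (0 : ℝ) < m := by exact_mod_cast hm
  have hN' : (0 : ℝ) < N := by exact_mod_cast hN
  have hw : 0 < (m : ℝ) / R := by positivity
  have hξ0 : ∀ i, 0 < ξ i := fun i => hξmin.trans_le (hξ i).1
  have hsq : ∀ i, (ξ i - estimate P R ξmin ξmax N ω i) ^ 2 ≤
      L / (2 * N) * (Real.exp (2 * (ξmax * (m / R))) / (m / R) ^ 2) := fun i =>
    (clipped_momentSolution_sub_sq_le hN hw (noChangeFraction_mem_Icc R N i ω) hξmin (hξ i)).trans
      (mul_le_mul_of_nonneg_right (hω i) (by positivity))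
  have hgap := (isOptimalRate_commitRate hm hR hξmin ξmax N ω).statUtility_sub_le hρ hζ hξmin
    (fun i => (hξ i).1) (fun i => le_max_left _ _) hsq
  have hle := statUtility_le_sum hζ hξ0 hρ
  have h1 : 0 ≤ (T - N * (m / R)) / m := div_nonneg (sub_nonneg.2 hT) hm'.le
  have h2 := mul_le_mul_of_nonneg_left hgap h1
  have h3 := mul_le_mul_of_nonneg_left hle (a := N * (m / R) / m) (by positivity)
  -- The horizon is split into `τ` and `T - τ`. In the final simplification, `1 / (2 N) = (m / R) /
  -- (2 τ)` converts the number of windows into time.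
  calc _ = N * (m / R) / m * statUtility ζ ρ ξ + (T - N * (m / R)) / m *
        (statUtility ζ ρ ξ - statUtility ζ (commitRate P R ξmin ξmax ζ N ω) ξ) := by ring
    _ ≤ _ := add_le_add h3 h2
    _ = _ := by
        rw [← mul_div_assoc ξmax]
        field_simp

variable [MeasurableSpace Ω] {μ : Measure Ω} [IsProbabilityMeasure μ]

/-- The high-probability regret bound of explore-and-commit. -/
theorem IsCrawlModel.le_measure_etcRegret_le (h : IsCrawlModel P ξ ζ μ) (hm : 0 < m) (hR : 0 < R)
    (hξmin : 0 < ξmin) {δ : ℝ} (hδ : δ ∈ Set.Ioo (0 : ℝ) 1) (hζ : ∀ i, 0 < ζ i)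
    (hξ : ∀ i, ξ i ∈ Set.Icc ξmin ξmax) (hN : 0 < N) (hT : N * (m / R) ≤ T) :
    ENNReal.ofReal (1 - δ) ≤ μ {ω |
      etcRegret μ P R ξmin ξmax ζ N T ω ≤
        (N * (m / R) / m + (T - N * (m / R)) / (N * (m / R)) * (Real.exp (2 * (ξmax * m / R)) * R *
          Real.log (2 * m / δ) / (2 * m ^ 2 * ξmin ^ 2))) * ∑ i, ζ i ∧
      etcStatRegret μ P R ξmin ξmax ζ ξ N T ω ≤
        (N * (m / R) / m + (T - N * (m / R)) / (N * (m / R)) * (Real.exp (2 * (ξmax * m / R)) * R *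
          Real.log (2 * m / δ) / (2 * m ^ 2 * ξmin ^ 2))) * ∑ i, ζ i} := by
  have hξ0 : ∀ i, 0 < ξ i := fun i => hξmin.trans_le (hξ i).1
  have hT0 : 0 ≤ T := le_trans (by positivity) hT
  have hopt := isOptimalRate_optimalRate hm hR.le ζ ξ hξ0
  set ρ := optimalRate R ζ ξ
  have hsup : sSup ((fun ρ' => statUtility ζ ρ' ξ) '' ratePolicies m R) ≤ statUtility ζ ρ ξ :=
    csSup_le (Set.Nonempty.image _ ⟨ρ, hopt.1⟩) (by rintro _ ⟨ρ', hρ', rfl⟩; exact hopt.2 hρ')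
  have hsup' : sSup ((fun ρ' => ∫ ω', utility P (rateSchedule P ρ' ω') 0 T ω' ∂μ) ''
      ratePolicies m R) ≤ T / m * statUtility ζ ρ ξ := by
    refine csSup_le (Set.Nonempty.image _ ⟨ρ, hopt.1⟩) ?_
    rintro _ ⟨ρ', hρ', rfl⟩
    exact (h.integral_utility_rateSchedule_le hm hξ0 hζ hρ' hT0).trans
      (mul_le_mul_of_nonneg_left (hopt.2 hρ') (by positivity))
  -- Of the utility earned while exploring only the sign is used.
  have hexplore : 0 ≤ ∫ ω', utility P (fun _ => uniformRefresh m R N) 0 (N * (m / R)) ω' ∂μ :=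
    integral_nonneg fun ω' => by unfold utility; positivity
  refine (h.le_measure_noChangeFraction hm hξ0 hR hN hδ).trans (measure_mono_ae ?_)
  filter_upwards [h.ae_le_condExp_etcSchedule hm hξ0 hζ (ξmax := ξmax) hR hξmin hT] with ω hcond hω
  have hgap := stationary_gap_le hm hR hξmin hζ hξ hN hT hω hopt.1
  refine ⟨le_trans ?_ hgap, le_trans ?_ hgap⟩
  · unfold etcRegret
    linarith
  · unfold etcStatRegret
    have := mul_le_mul_of_nonneg_left hsup (a := T / m) (by positivity)
    linarith

end Model

/-! ### Choice of the exploration horizon -/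

/-- The number of exploration windows used for the time horizon `T`. -/
noncomputable def exploreWindows (T : ℝ) : ℕ := ⌈√T⌉₊

theorem sqrt_le_exploreWindows (T : ℝ) : √T ≤ exploreWindows T := Nat.le_ceil _

theorem exploreWindows_le {T : ℝ} (hT : 1 ≤ T) : (exploreWindows T : ℝ) ≤ 2 * √T := by
  have h1 : (exploreWindows T : ℝ) < √T + 1 := Nat.ceil_lt_add_one (Real.sqrt_nonneg T)
  have h2 : 1 ≤ √T := Real.one_le_sqrt.2 hT
  linarith

theorem isTheta_exploreWindows {c : ℝ} (hc : 0 < c) :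
    (fun T => (exploreWindows T : ℝ) * c) =Θ[atTop] fun T => √T := by
  constructor
  · refine IsBigO.of_bound (2 * c) ?_
    filter_upwards [eventually_ge_atTop 1] with T hT
    rw [Real.norm_of_nonneg (by positivity), Real.norm_of_nonneg (by positivity)]
    nlinarith [exploreWindows_le hT]
  · refine IsBigO.of_bound c⁻¹ (Eventually.of_forall fun T => ?_)
    rw [Real.norm_of_nonneg (by positivity), Real.norm_of_nonneg (by positivity),
      mul_comm (exploreWindows T : ℝ), inv_mul_cancel_left₀ hc.ne']
    exact sqrt_le_exploreWindows T

theorem eventually_exploreWindows {c : ℝ} (hc : 0 < c) :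
    ∀ᶠ T in atTop, 0 < (exploreWindows T : ℝ) * c ∧ (exploreWindows T : ℝ) * c ≤ T := by
  filter_upwards [eventually_ge_atTop 1, eventually_ge_atTop ((2 * c) ^ 2)] with T hT hT'
  have h1 : 1 ≤ √T := Real.one_le_sqrt.2 hT
  have h2 := sqrt_le_exploreWindows T
  have h3 : 2 * c ≤ √T := Real.le_sqrt_of_sq_le hT'
  refine ⟨by nlinarith, ?_⟩
  calc (exploreWindows T : ℝ) * c ≤ 2 * √T * c := by gcongr; exact exploreWindows_le hT
    _ = √T * (2 * c) := by ring
    _ ≤ √T * √T := by gcongr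
    _ = T := Real.mul_self_sqrt (by linarith)

/-- The number of windows lies between `√T` and `2 √T`: the upper bound controls the cost of
exploration, the lower bound the cost of estimation. -/
theorem exploreWindows_bound_le {c K a T : ℝ} (hc : 0 < c) (hK : 0 ≤ K) (ha : 0 < a)
    (hT : 1 ≤ T) :
    (exploreWindows T : ℝ) * c / a + (T - exploreWindows T * c) / (exploreWindows T * c) * K ≤
      (2 * c / a + K / c) * √T := by
  have h1 : 1 ≤ √T := Real.one_le_sqrt.2 hT
  have h2 := sqrt_le_exploreWindows T
  have hpos : 0 < (exploreWindows T : ℝ) := by linarith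
  have h3 : (exploreWindows T : ℝ) * c / a ≤ 2 * c / a * √T := by
    calc (exploreWindows T : ℝ) * c / a ≤ 2 * √T * c / a := by gcongr; exact exploreWindows_le hT
      _ = _ := by ring
  have h4 : (T - exploreWindows T * c) / (exploreWindows T * c) ≤ √T / c := by
    rw [div_le_div_iff₀ (by positivity) hc]
    have h5 : √T * √T = T := Real.mul_self_sqrt (by linarith)
    have h6 : T ≤ √T * exploreWindows T := by nlinarith
    have h7 : 0 < (exploreWindows T : ℝ) * c := by positivity
    nlinarith
  calc _ ≤ 2 * c / a * √T + √T / c * K := add_le_add h3 (mul_le_mul_of_nonneg_right h4 hK)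
    _ = _ := by ring

theorem mainTheorem1 (m : ℕ) (hm : 0 < m) (R ξmin ξmax δ : ℝ) (hR : 0 < R) (hξmin : 0 < ξmin)
    (hδ : δ ∈ Set.Ioo (0 : ℝ) 1) :
    (∀ (ζ ξ : Fin m → ℝ), (∀ i, 0 < ζ i) → (∀ i, ξ i ∈ Set.Icc ξmin ξmax) →
      ∀ (Ω : Type*) [MeasurableSpace Ω] (μ : Measure Ω) [IsProbabilityMeasure μ]
        (P : CrawlProcesses Ω m), IsCrawlModel P ξ ζ μ →
      ∀ (T τ : ℝ) (N : ℕ), 0 < τ → τ ≤ T → τ = N * (m / R) →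
        ENNReal.ofReal (1 - δ) ≤ μ {ω |
          etcRegret μ P R ξmin ξmax ζ N T ω ≤
            (τ / m + (T - τ) / τ * (Real.exp (2 * (ξmax * m / R)) * R * Real.log (2 * m / δ) /
              (2 * m ^ 2 * ξmin ^ 2))) * ∑ i, ζ i ∧
          etcStatRegret μ P R ξmin ξmax ζ ξ N T ω ≤
            (τ / m + (T - τ) / τ * (Real.exp (2 * (ξmax * m / R)) * R * Real.log (2 * m / δ) /
              (2 * m ^ 2 * ξmin ^ 2))) * ∑ i, ζ i}) ∧
    (∃ N : ℝ → ℕ,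
      ((fun T => (N T : ℝ) * (m / R)) =Θ[atTop] fun T => √T) ∧
      (∀ᶠ T in atTop, 0 < (N T : ℝ) * (m / R) ∧ (N T : ℝ) * (m / R) ≤ T) ∧
      ∀ ζ : Fin m → ℝ, (∀ i, 0 < ζ i) →
        ∃ C : ℝ, ∀ᶠ T in atTop, ∀ ξ : Fin m → ℝ, (∀ i, ξ i ∈ Set.Icc ξmin ξmax) →
          ∀ (Ω : Type*) [MeasurableSpace Ω] (μ : Measure Ω) [IsProbabilityMeasure μ]
            (P : CrawlProcesses Ω m), IsCrawlModel P ξ ζ μ →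
            ENNReal.ofReal (1 - δ) ≤ μ {ω |
              etcRegret μ P R ξmin ξmax ζ (N T) T ω ≤ C * √T ∧
              etcStatRegret μ P R ξmin ξmax ζ ξ (N T) T ω ≤ C * √T}) := by
  have hm' : (0 : ℝ) < m := by exact_mod_cast hm
  have hw : 0 < (m : ℝ) / R := by positivity
  have hpos : ∀ N : ℕ, 0 < (N : ℝ) * (m / R) → 0 < N := fun N hN => by
    exact_mod_cast pos_of_mul_pos_left hN hw.le
  refine ⟨?_, exploreWindows, isTheta_exploreWindows hw, eventually_exploreWindows hw, ?_⟩
  · rintro ζ ξ hζ hξ Ω _ μ _ P h T τ N hτ hτT rfl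
    exact h.le_measure_etcRegret_le hm hR hξmin hδ hζ hξ (hpos N hτ) hτT
  · intro ζ hζ
    set K : ℝ := Real.exp (2 * (ξmax * m / R)) * R * Real.log (2 * m / δ) /
      (2 * m ^ 2 * ξmin ^ 2) with hK
    have hK0 : 0 ≤ K := by
      have hL : 0 ≤ Real.log (2 * m / δ) := by
        refine Real.log_nonneg ?_
        have : (1 : ℝ) ≤ m := by exact_mod_cast hm
        rw [le_div_iff₀ hδ.1]
        linarith [hδ.2]
      positivity
    have hζ0 : 0 ≤ ∑ i, ζ i := Finset.sum_nonneg fun i _ => (hζ i).le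
    -- The constant of `exploreWindows_bound_le` with `c = m / R` and `a = m`, times the total
    -- request rate. It does not involve `ξ`, and neither does the threshold on `T`, hence the
    -- uniformity.
    refine ⟨(2 * (m / R) / m + K / (m / R)) * ∑ i, ζ i, ?_⟩
    filter_upwards [eventually_exploreWindows hw, eventually_ge_atTop 1] with T hT hT1
    intro ξ hξ Ω _ μ _ P h
    have hbound := mul_le_mul_of_nonneg_right (exploreWindows_bound_le hw hK0 hm' hT1) hζ0
    rw [mul_right_comm] at hbound
    exact (h.le_measure_etcRegret_le hm hR hξmin hδ hζ hξ (hpos _ hT.1) hT.2).trans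
      (measure_mono fun ω hω => ⟨hω.1.trans hbound, hω.2.trans hbound⟩)
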